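/- Let $n\ge 2$ and let $K\subset\mathbb R^n$ be a convex body, i.e. a compact convex set with non-empty interior. Let $V_n$ denote the Euclidean volume, $V(\cdot,\dots,\cdot)$ the $n$-dimensional mixed volume (normalized by $V(K,\dots,K)=V_n(K)$), and write $K[m]$ for $K$ repeated $m$ times. Suppose that $$V(L_1,L_2,K[n-2])\,V_n(K)\le V(L_1,K[n-1])\,V(L_2,K[n-1])$$ for all convex bodies $L_1,L_2\subset\mathbb R^n$. Let $h_K(u)=\max_{x\in K}\langle x,u\rangle$ be the support function of $K$, let $K^u=\{x\in K:\langle x,u\rangle=h_K(u)\}$ be the face of $K$ with outer normal $u\in\mathbb S^{n-1}$, and let $S_K$ be the surface area measure of $K$ on $\mathbb S^{n-1}$, i.e. for every Borel set $\Omega\subset\mathbb S^{n-1}$, $S_K(\Omega)$ is the $(n-1)$-dimensional Hausdorff measure of the set of all $x\in\partial K$ with $\langle x,u\rangle=h_K(u)$ for some $u\in\Omega$. Then $\dim K^u>0$ for every $u$ in the support of $S_K$, where $\dim$ is the dimension of the affine hull and the support of $S_K$ is the set of points of $\mathbb S^{n-1}$ all of whose open neighborhoods have positive $S_K$-measure.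 -/

import Mathlib

open MeasureTheory
open scoped RealInnerProductSpace

namespace ConvexMixed

/-! ### Mixed volumes

`ConvexBody V` is Mathlib's type of nonempty compact convex sets; non-empty interior is required
separately wherever it is needed. -/

/-- `p` is the volume polynomial of `L₁, …, Lₙ`: for all `c₁, …, cₙ ≥ 0` the volume of
`c₁ L₁ + ⋯ + cₙ Lₙ` equals `p (c₁, …, cₙ)`. -/
def IsVolumePolynomial {n : ℕ} (L : Fin n → ConvexBody (EuclideanSpace ℝ (Fin n)))
    (p : MvPolynomial (Fin n) ℝ) : Prop :=
  ∀ c : Fin n → ℝ, (∀ i, 0 ≤ c i) →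
    volume.real ((∑ i, c i • L i : ConvexBody (EuclideanSpace ℝ (Fin n))) :
      Set (EuclideanSpace ℝ (Fin n))) = MvPolynomial.eval c p

/-- The volume polynomial is unique. -/
theorem IsVolumePolynomial.unique {n : ℕ}
    {L : Fin n → ConvexBody (EuclideanSpace ℝ (Fin n))} {p q : MvPolynomial (Fin n) ℝ}
    (hp : IsVolumePolynomial L p) (hq : IsVolumePolynomial L q) : p = q := by
  refine MvPolynomial.funext_set (s := fun _ => Set.Ici (0 : ℝ)) (fun _ => Set.Ici_infinite 0) ?_
  intro c hc
  have h0 : ∀ i, 0 ≤ c i := fun i => hc i (Set.mem_univ i)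
  rw [← hp c h0, ← hq c h0]

open Classical in
/-- The mixed volume `V(L₁, …, Lₙ)`: the coefficient of `c₁ c₂ ⋯ cₙ` in the volume polynomial of
`L₁, …, Lₙ` (which exists by a theorem of Minkowski), divided by `n!`, so that
`V(L, …, L)` is the volume of `L`. -/
noncomputable def mixedVolume {n : ℕ}
    (L : Fin n → ConvexBody (EuclideanSpace ℝ (Fin n))) : ℝ :=
  if h : ∃ p : MvPolynomial (Fin n) ℝ, IsVolumePolynomial L p then
    (h.choose.coeff (Finsupp.equivFunOnFinite.symm fun _ => 1)) / (n.factorial : ℝ)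
  else 0

/-- The family `L, K, …, K` with `K` repeated `n - 1` times. -/
def family₁ {n : ℕ} (L K : ConvexBody (EuclideanSpace ℝ (Fin n))) :
    Fin n → ConvexBody (EuclideanSpace ℝ (Fin n)) :=
  fun i => if i.val = 0 then L else K

/-- The family `L₁, L₂, K, …, K` with `K` repeated `n - 2` times (for `n ≥ 2`). -/
def family₂ {n : ℕ} (L₁ L₂ K : ConvexBody (EuclideanSpace ℝ (Fin n))) :
    Fin n → ConvexBody (EuclideanSpace ℝ (Fin n)) :=
  fun i => if i.val = 0 then L₁ else if i.val = 1 then L₂ else K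

/-- The Bezout inequality
`V(L₁, L₂, K[n-2]) Vₙ(K) ≤ V(L₁, K[n-1]) V(L₂, K[n-1])` for all convex bodies `L₁, L₂`
(with non-empty interior). -/
def SatisfiesBezout {n : ℕ} (K : ConvexBody (EuclideanSpace ℝ (Fin n))) : Prop :=
  ∀ L₁ L₂ : ConvexBody (EuclideanSpace ℝ (Fin n)),
    (interior (L₁ : Set (EuclideanSpace ℝ (Fin n)))).Nonempty →
    (interior (L₂ : Set (EuclideanSpace ℝ (Fin n)))).Nonempty →
    mixedVolume (family₂ L₁ L₂ K) * volume.real (K : Set (EuclideanSpace ℝ (Fin n))) ≤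
      mixedVolume (family₁ L₁ K) * mixedVolume (family₁ L₂ K)

/-! ### Support function, faces and the surface area measure -/

section Surface

variable {n : ℕ} (K : ConvexBody (EuclideanSpace ℝ (Fin n)))

/-- The support function `h_K(u) = max {⟪x, u⟫ | x ∈ K}`. -/
noncomputable def supportFn (u : EuclideanSpace ℝ (Fin n)) : ℝ :=
  sSup ((fun x => ⟪x, u⟫) '' (K : Set (EuclideanSpace ℝ (Fin n))))

/-- The face `K^u = {x ∈ K | ⟪x, u⟫ = h_K(u)}`. -/
def face (u : EuclideanSpace ℝ (Fin n)) : Set (EuclideanSpace ℝ (Fin n)) :=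
  {x | x ∈ K ∧ ⟪x, u⟫ = supportFn K u}

/-- The dimension of a set: the dimension of the smallest affine subspace containing it. -/
noncomputable def affineDim (A : Set (EuclideanSpace ℝ (Fin n))) : ℕ :=
  Module.finrank ℝ (affineSpan ℝ A).direction

/-- The inverse spherical image `τ(K, Ω)`: the boundary points of `K` that have an outer unit
normal vector in `Ω`. -/
def invSphericalImage (Ω : Set (Metric.sphere (0 : EuclideanSpace ℝ (Fin n)) 1)) :
    Set (EuclideanSpace ℝ (Fin n)) :=
  {x | x ∈ frontier (K : Set (EuclideanSpace ℝ (Fin n))) ∧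
    ∃ u ∈ Ω, ⟪x, (u : EuclideanSpace ℝ (Fin n))⟫ = supportFn K u}

variable {K}

theorem inner_le_supportFn {x : EuclideanSpace ℝ (Fin n)} (hx : x ∈ K)
    (u : EuclideanSpace ℝ (Fin n)) : ⟪x, u⟫ ≤ supportFn K u :=
  le_csSup (K.isCompact.image (by fun_prop)).bddAbove ⟨x, hx, rfl⟩

theorem continuous_supportFn : Continuous (supportFn K) := by
  have h := K.isCompact.continuous_sSup (f := fun (u x : EuclideanSpace ℝ (Fin n)) => ⟪x, u⟫)
    (by fun_prop)
  exact h

theorem dimH_flat_le (i j : Fin n) (hij : i ≠ j) (p q : ℝ) :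
    dimH {z : EuclideanSpace ℝ (Fin n) | z i = p ∧ z j = q} ≤ ((n - 2 : ℕ) : ENNReal) := by
  let F : ({k : Fin n // k ∈ ({i, j} : Finset (Fin n))ᶜ} → ℝ) → EuclideanSpace ℝ (Fin n) :=
    fun w => WithLp.toLp 2 fun k =>
      if h : k ∈ ({i, j} : Finset (Fin n))ᶜ then w ⟨k, h⟩ else if k = i then p else q
  have hF : ContDiff ℝ 1 F := by
    rw [contDiff_euclidean]
    intro k
    by_cases h : k ∈ ({i, j} : Finset (Fin n))ᶜ
    · simp only [F, h, dite_true]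
      fun_prop
    · simp only [F, h, dite_false]
      fun_prop
  have h1 := hF.dimH_range_le
  have h2 : Module.finrank ℝ ({k : Fin n // k ∈ ({i, j} : Finset (Fin n))ᶜ} → ℝ) = n - 2 := by
    rw [Module.finrank_fintype_fun_eq_card, Fintype.card_coe, Finset.card_compl,
      Finset.card_pair hij, Fintype.card_fin]
  rw [h2] at h1
  refine (dimH_mono ?_).trans h1
  rintro z ⟨hi, hj⟩
  refine ⟨fun k => z k, ?_⟩
  ext k
  by_cases h : k ∈ ({i, j} : Finset (Fin n))ᶜ
  · simp only [F, h, dite_true]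
  · simp only [F, h, dite_false]
    simp only [Finset.mem_compl, Finset.mem_insert, Finset.mem_singleton, not_not] at h
    rcases h with rfl | rfl
    · simp [hi]
    · simp [hij.symm, hj]

/-- The set of nearest points in `K` of the points of `A`. -/
def nearestPts (K : ConvexBody (EuclideanSpace ℝ (Fin n))) (A : Set (EuclideanSpace ℝ (Fin n))) :
    Set (EuclideanSpace ℝ (Fin n)) :=
  {x | x ∈ K ∧ ∃ q ∈ A, ∀ y ∈ K, ⟪q - x, y - x⟫ ≤ 0}

theorem dimH_nearestPts_le (A : Set (EuclideanSpace ℝ (Fin n))) :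
    dimH (nearestPts K A) ≤ dimH A := by
  classical
  let P : EuclideanSpace ℝ (Fin n) → EuclideanSpace ℝ (Fin n) → Prop :=
    fun q x => x ∈ K ∧ ∀ y ∈ K, ⟪q - x, y - x⟫ ≤ 0
  have key : ∀ q q' x x', P q x → P q' x' → dist x x' ≤ dist q q' := by
    intro q q' x x' h h'
    have h1 := h.2 x' h'.1
    have h2 := h'.2 x h.1
    have h3 : ⟪x - x', x - x'⟫ ≤ ⟪q - q', x - x'⟫ := by
      simp only [inner_sub_left, inner_sub_right] at h1 h2 ⊢
      linarith
    have h4 := real_inner_le_norm (q - q') (x - x')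
    rw [real_inner_self_eq_norm_sq] at h3
    rw [dist_eq_norm, dist_eq_norm]
    by_contra! hlt
    have := norm_nonneg (q - q')
    nlinarith [norm_nonneg (x - x')]
  let f : EuclideanSpace ℝ (Fin n) → EuclideanSpace ℝ (Fin n) :=
    fun q => if h : ∃ x, P q x then h.choose else 0
  have hf : ∀ q x, P q x → f q = x := by
    intro q x h
    have hex : ∃ x, P q x := ⟨x, h⟩
    have h1 : f q = hex.choose := by simp only [f, hex, dite_true]
    rw [h1, ← dist_le_zero]
    simpa using key q q _ _ hex.choose_spec h
  have hL : LipschitzOnWith 1 f (A ∩ {q | ∃ x, P q x}) := by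
    refine LipschitzOnWith.of_dist_le_mul ?_
    rintro q ⟨-, x, hx⟩ q' ⟨-, x', hx'⟩
    rw [hf q x hx, hf q' x' hx']
    simpa using key q q' x x' hx hx'
  have h1 := hL.dimH_image_le
  refine le_trans (dimH_mono ?_) (h1.trans (dimH_mono Set.inter_subset_left))
  rintro x ⟨hx, q, hq, hqx⟩
  exact ⟨q, ⟨hq, x, hx, hqx⟩, hf q x ⟨hx, hqx⟩⟩

theorem nearestPts_flat_null (i j : Fin n) (hij : i ≠ j) (p q : ℝ) :
    (Measure.euclideanHausdorffMeasure (n - 1) : Measure (EuclideanSpace ℝ (Fin n)))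
      (nearestPts K {z | z i = p ∧ z j = q}) = 0 := by
  have hn : 2 ≤ n := by
    have := Fin.val_ne_of_ne hij
    omega
  have h : dimH (nearestPts K {z | z i = p ∧ z j = q}) < (((n - 1 : ℕ) : NNReal) : ENNReal) := by
    refine ((dimH_nearestPts_le _).trans (dimH_flat_le i j hij p q)).trans_lt ?_
    norm_cast
    omega
  have h0 := hausdorffMeasure_of_dimH_lt h
  rw [Measure.euclideanHausdorffMeasure_def, Measure.smul_apply]
  simp only [NNReal.coe_natCast] at h0
  rw [h0, smul_zero]

/-- For two distinct outer unit normals at a point of a convex body with non-empty interior, some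
`2 × 2` minor of the coordinates does not vanish. -/
theorem exists_minor_ne_zero (hK : (interior (K : Set (EuclideanSpace ℝ (Fin n)))).Nonempty)
    {x u v : EuclideanSpace ℝ (Fin n)} (hu1 : ‖u‖ = 1) (hv1 : ‖v‖ = 1)
    (huv : u ≠ v) (hu : ⟪x, u⟫ = supportFn K u) (hv : ⟪x, v⟫ = supportFn K v) :
    ∃ i j : Fin n, i ≠ j ∧ u i * v j - u j * v i ≠ 0 := by
  by_contra! hcon
  have hm : ∀ i j, u i * v j = u j * v i := by
    intro i j
    by_cases hij : i = j
    · subst hij; ring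
    · linarith [hcon i j hij]
  have hv0 : ⟪v, v⟫ = 1 := by rw [real_inner_self_eq_norm_sq, hv1]; norm_num
  have hu0 : ⟪u, u⟫ = 1 := by rw [real_inner_self_eq_norm_sq, hu1]; norm_num
  have hus : u = ⟪u, v⟫ • v := by
    ext i
    have : ⟪v, v⟫ * u i = ⟪u, v⟫ * v i := by
      simp only [PiLp.inner_apply, RCLike.inner_apply, conj_trivial, Finset.sum_mul]
      refine Finset.sum_congr rfl fun j _ => ?_
      linear_combination (v j) * hm i j
    rw [hv0, one_mul] at this
    simpa using this
  have hsq : ⟪u, v⟫ * ⟪u, v⟫ = 1 := by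
    have h := hu0
    rw [hus, inner_smul_left, inner_smul_right, hv0] at h
    simpa using h
  have hneg : ⟪u, v⟫ = -1 := by
    rcases mul_self_eq_one_iff.mp hsq with h | h
    · rw [h, one_smul] at hus
      exact absurd hus huv
    · exact h
  have hun : u = -v := by rw [hneg] at hus; simpa using hus
  have hflat : ∀ y ∈ K, ⟪y, v⟫ = ⟪x, v⟫ := by
    intro y hy
    have h1 := inner_le_supportFn hy u
    have h2 := inner_le_supportFn hy v
    rw [← hu, hun, inner_neg_right, inner_neg_right] at h1
    rw [← hv] at h2
    linarith
  obtain ⟨c, hc⟩ := hK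
  obtain ⟨ε, hε, hball⟩ := Metric.isOpen_iff.mp isOpen_interior c hc
  have hmem : c + (ε / 2) • v ∈ K := by
    refine interior_subset (hball ?_)
    rw [Metric.mem_ball, dist_eq_norm, add_sub_cancel_left, norm_smul, hv1, Real.norm_eq_abs,
      abs_of_pos (by positivity)]
    linarith
  have h1 := hflat _ hmem
  have h2 := hflat c (interior_subset hc)
  rw [inner_add_left, inner_smul_left, hv0, h2] at h1
  simp at h1
  linarith

/-- The set of points of `K` with at least two outer unit normals. -/
def singularPts (K : ConvexBody (EuclideanSpace ℝ (Fin n))) : Set (EuclideanSpace ℝ (Fin n)) :=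
  {x | x ∈ K ∧ ∃ u v : EuclideanSpace ℝ (Fin n), ‖u‖ = 1 ∧ ‖v‖ = 1 ∧ u ≠ v ∧
    ⟪x, u⟫ = supportFn K u ∧ ⟪x, v⟫ = supportFn K v}

theorem singularPts_null (hK : (interior (K : Set (EuclideanSpace ℝ (Fin n)))).Nonempty) :
    (Measure.euclideanHausdorffMeasure (n - 1) : Measure (EuclideanSpace ℝ (Fin n)))
      (singularPts K) = 0 := by
  have hsub : singularPts K ⊆ ⋃ (i : Fin n) (j : Fin n) (_ : i ≠ j) (p : ℚ) (q : ℚ),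
      nearestPts K {z | z i = (p : ℝ) ∧ z j = (q : ℝ)} := by
    rintro x ⟨hxK, u, v, hu1, hv1, huv, hu, hv⟩
    obtain ⟨i, j, hij, hD⟩ := exists_minor_ne_zero hK hu1 hv1 huv hu hv
    set D := u i * v j - u j * v i with hDdef
    -- solve `a u + b v = (p, q) - x` in the coordinates `i, j`
    let G : ℝ × ℝ → ℝ × ℝ := fun w =>
      (((w.1 - x i) * v j - (w.2 - x j) * v i) / D, ((w.2 - x j) * u i - (w.1 - x i) * u j) / D)
    have hGc : Continuous G := by fun_prop
    have hopen : IsOpen (G ⁻¹' (Set.Ioi 0 ×ˢ Set.Ioi 0)) :=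
      (isOpen_Ioi.prod isOpen_Ioi).preimage hGc
    have hne : (G ⁻¹' (Set.Ioi 0 ×ˢ Set.Ioi 0)).Nonempty := by
      refine ⟨(x i + u i + v i, x j + u j + v j), ?_⟩
      have h1 : ((x i + u i + v i - x i) * v j - (x j + u j + v j - x j) * v i) / D = 1 := by
        rw [div_eq_one_iff_eq hD, hDdef]; ring
      have h2 : ((x j + u j + v j - x j) * u i - (x i + u i + v i - x i) * u j) / D = 1 := by
        rw [div_eq_one_iff_eq hD, hDdef]; ring
      simp only [G, Set.mem_preimage, Set.mem_prod, Set.mem_Ioi, h1, h2]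
      norm_num
    have hdense : DenseRange (Prod.map (fun p : ℚ => (p : ℝ)) (fun p : ℚ => (p : ℝ))) :=
      Rat.denseRange_cast.prodMap Rat.denseRange_cast
    obtain ⟨⟨p, q⟩, hpq⟩ := hdense.exists_mem_open hopen hne
    simp only [G, Set.mem_preimage, Set.mem_prod, Set.mem_Ioi, Prod.map_apply] at hpq
    obtain ⟨ha, hb⟩ := hpq
    set a := (((p : ℝ) - x i) * v j - ((q : ℝ) - x j) * v i) / D with haD
    set b := (((q : ℝ) - x j) * u i - ((p : ℝ) - x i) * u j) / D with hbD
    have haD' : a * D = ((p : ℝ) - x i) * v j - ((q : ℝ) - x j) * v i := by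
      rw [haD]; field_simp
    have hbD' : b * D = ((q : ℝ) - x j) * u i - ((p : ℝ) - x i) * u j := by
      rw [hbD]; field_simp
    simp only [Set.mem_iUnion]
    refine ⟨i, j, hij, p, q, hxK, x + (a • u + b • v), ⟨?_, ?_⟩, ?_⟩
    · simp only [PiLp.add_apply, PiLp.smul_apply, smul_eq_mul]
      have : D * (x i + (a * u i + b * v i) - p) = 0 := by
        linear_combination (u i) * haD' + (v i) * hbD' + ((p : ℝ) - x i) * hDdef
      have := (mul_eq_zero.mp this).resolve_left hD
      linarith
    · simp only [PiLp.add_apply, PiLp.smul_apply, smul_eq_mul]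
      have : D * (x j + (a * u j + b * v j) - q) = 0 := by
        linear_combination (u j) * haD' + (v j) * hbD' + ((q : ℝ) - x j) * hDdef
      have := (mul_eq_zero.mp this).resolve_left hD
      linarith
    · intro y hy
      have h1 := inner_le_supportFn hy u
      have h2 := inner_le_supportFn hy v
      rw [← hu] at h1
      rw [← hv] at h2
      rw [add_sub_cancel_left, inner_add_left, inner_smul_left, inner_smul_left,
        real_inner_comm, real_inner_comm (y - x) v, inner_sub_left, inner_sub_left]
      simp only [conj_trivial]
      nlinarith
  refine measure_mono_null hsub ?_
  simp only [measure_iUnion_null_iff]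
  exact fun i j hij p q => nearestPts_flat_null i j hij p q

theorem isClosed_invSphericalImage
    {Ω : Set (Metric.sphere (0 : EuclideanSpace ℝ (Fin n)) 1)} (hΩ : IsClosed Ω) :
    IsClosed (invSphericalImage K Ω) := by
  have hcl : IsClosed {w : EuclideanSpace ℝ (Fin n) × Metric.sphere (0 : EuclideanSpace ℝ (Fin n)) 1 |
      w.1 ∈ frontier (K : Set (EuclideanSpace ℝ (Fin n))) ∧ w.2 ∈ Ω ∧
        ⟪w.1, (w.2 : EuclideanSpace ℝ (Fin n))⟫ = supportFn K w.2} := by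
    refine (isClosed_frontier.preimage continuous_fst).inter
      ((hΩ.preimage continuous_snd).inter (isClosed_eq (by fun_prop) ?_))
    exact continuous_supportFn.comp (continuous_subtype_val.comp continuous_snd)
  have := isClosedMap_fst_of_compactSpace _ hcl
  convert this using 1
  ext x
  constructor
  · rintro ⟨hx, u, hu, h⟩
    exact ⟨(x, u), ⟨hx, hu, h⟩, rfl⟩
  · rintro ⟨⟨y, u⟩, ⟨hx, hu, h⟩, rfl⟩
    exact ⟨hx, u, hu, h⟩

variable (K) in
/-- The set function `Ω ↦ ℋⁿ⁻¹(τ(K, Ω))` as an outer measure on the sphere. Here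
`euclideanHausdorffMeasure d` is the `d`-dimensional Hausdorff measure, normalized to agree with
Lebesgue measure on `ℝᵈ`. -/
noncomputable def surfaceAreaOuter :
    OuterMeasure (Metric.sphere (0 : EuclideanSpace ℝ (Fin n)) 1) where
  measureOf Ω := (Measure.euclideanHausdorffMeasure (n - 1) :
    Measure (EuclideanSpace ℝ (Fin n))) (invSphericalImage K Ω)
  empty := by
    have : invSphericalImage K ∅ = ∅ := by ext x; simp [invSphericalImage]
    rw [this, measure_empty]
  mono h := measure_mono fun _ ⟨hx, u, hu, e⟩ => ⟨hx, u, h hu, e⟩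
  iUnion_nat s _ := by
    refine (measure_mono ?_).trans (measure_iUnion_le _)
    rintro x ⟨hx, u, hu, e⟩
    obtain ⟨k, hk⟩ := Set.mem_iUnion.mp hu
    exact Set.mem_iUnion.mpr ⟨k, hx, u, hk, e⟩

/-- Borel sets are Carathéodory measurable for `Ω ↦ ℋⁿ⁻¹(τ(K, Ω))`. -/
theorem borel_le_caratheodory (hK : (interior (K : Set (EuclideanSpace ℝ (Fin n)))).Nonempty) :
    (inferInstance : MeasurableSpace (Metric.sphere (0 : EuclideanSpace ℝ (Fin n)) 1)) ≤
      (surfaceAreaOuter K).caratheodory := by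
  rw [BorelSpace.measurable_eq (α := Metric.sphere (0 : EuclideanSpace ℝ (Fin n)) 1),
    borel_eq_generateFrom_isClosed]
  refine MeasurableSpace.generateFrom_le fun Ω hΩ => ?_
  rw [OuterMeasure.isCaratheodory_iff_le]
  intro T
  let μ : Measure (EuclideanSpace ℝ (Fin n)) := Measure.euclideanHausdorffMeasure (n - 1)
  change μ (invSphericalImage K (T ∩ Ω)) + μ (invSphericalImage K (T \ Ω)) ≤
    μ (invSphericalImage K T)
  rw [← measure_inter_add_sdiff (invSphericalImage K T)
    (isClosed_invSphericalImage (K := K) hΩ).measurableSet]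
  refine add_le_add (measure_mono ?_) ?_
  · rintro x ⟨hx, u, hu, e⟩
    exact ⟨⟨hx, u, hu.1, e⟩, ⟨hx, u, hu.2, e⟩⟩
  · have hnull : μ (singularPts K) = 0 := singularPts_null hK
    have hsub : invSphericalImage K (T \ Ω) ⊆
        (invSphericalImage K T \ invSphericalImage K Ω) ∪ singularPts K := by
      rintro x ⟨hx, u, hu, e⟩
      by_cases hxs : x ∈ invSphericalImage K Ω
      · obtain ⟨-, v, hv, e'⟩ := hxs
        refine Or.inr ⟨K.isClosed.frontier_subset hx, u, v, by simp, by simp, ?_, e, e'⟩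
        intro h
        exact hu.2 (Subtype.ext h ▸ hv)
      · exact Or.inl ⟨⟨hx, u, hu.1, e⟩, hxs⟩
    calc μ (invSphericalImage K (T \ Ω))
        ≤ μ ((invSphericalImage K T \ invSphericalImage K Ω) ∪ singularPts K) := measure_mono hsub
      _ ≤ μ (invSphericalImage K T \ invSphericalImage K Ω) + μ (singularPts K) :=
          measure_union_le _ _
      _ = _ := by rw [hnull, add_zero]

/-- The surface area measure `S_K` on the unit sphere of a convex body `K` with non-empty interior:
`S_K(Ω) = ℋⁿ⁻¹(τ(K, Ω))` for Borel sets `Ω`. -/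
noncomputable def surfaceAreaMeasure (K : ConvexBody (EuclideanSpace ℝ (Fin n)))
    (hK : (interior (K : Set (EuclideanSpace ℝ (Fin n)))).Nonempty) :
    Measure (Metric.sphere (0 : EuclideanSpace ℝ (Fin n)) 1) :=
  (surfaceAreaOuter K).toMeasure (borel_le_caratheodory hK)

theorem surfaceAreaMeasure_apply (hK : (interior (K : Set (EuclideanSpace ℝ (Fin n)))).Nonempty)
    {Ω : Set (Metric.sphere (0 : EuclideanSpace ℝ (Fin n)) 1)} (hΩ : MeasurableSet Ω) :
    surfaceAreaMeasure K hK Ω =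
      (Measure.euclideanHausdorffMeasure (n - 1) : Measure (EuclideanSpace ℝ (Fin n)))
        (invSphericalImage K Ω) :=
  toMeasure_apply _ _ hΩ

end Surface

end ConvexMixed

/-!
Suppose that the face of `K` with normal `u` is a single point `x₀`, and let `T` be `K` with a small
cap in direction `u` cut off. The support functions of `T` and `K` differ only at normals of `K` at
points near `x₀`. Since `K` has interior points, there is a convex body `M` with interior points
that has `x₀` as a vertex and looks like the point `x₀` in all these directions
(`exists_truncation_vertex`). Consequently `M` does not see the truncation, that is,
`V(T, M, K[n-2]) = V(K, M, K[n-2]) = V(M, K[n-1])` (`mixedVolume_family₂_eq_family₁`): passing from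
`a T + c K` to `(a + c) K` changes the volume by the same amount with and without a summand `b M`,
by an explicit decomposition of `(a + c) K + b M` into two convex pieces
(`volume_sub_volume_eq_of_supportFn`). As `V(M, K[n-1]) > 0`, the Bezout inequality for `T` and `M`
reduces to `Vₙ(K) ≤ V(T, K[n-1])`.

This says that `Vₙ((1 + a) K) - Vₙ(a T + K)` is of order `a²` as `a → 0`. But near every boundary
point of `K` with a normal `v` close to `u`, the difference of `(1 + a) K` and `a T + K` contains a
ball of radius proportional to `a`, because `h_K - h_T` is bounded below near `u`. Packing such
balls shows that the set of these boundary points is null for the Hausdorff measure of dimension `n - 1`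
(`hausdorffMeasure_eq_zero_of_volume_sub_le`), so `u` is not in the support of `S_K`.

Mixed volumes are coefficients of a volume polynomial, so Minkowski's theorem on its existence is
needed (`exists_volume_polynomial`). With `P_L` the nearest point map of `L`, the map `∑ cᵢ P_{Lᵢ}`
sends `ℝⁿ` into `∑ cᵢ Lᵢ` and onto its interior, is Lipschitz and monotone, and is injective where
its derivative is invertible. By Rademacher's theorem and the area formula,
`Vₙ(∑ cᵢ Lᵢ) = ∫ det (∑ cᵢ DP_{Lᵢ}(x)) dx`, and the integrand is a homogeneous polynomial in `c` for
almost every `x`. Integrating it needs no bounds on single coefficients, because a homogeneous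
polynomial is a fixed linear function of its values at finitely many nonnegative nodes.
-/

namespace ConvexMixed

open Set Filter Topology
open scoped NNReal ENNReal Pointwise

variable {n : ℕ}

/-! ### Support functions -/

theorem exists_inner_eq_supportFn (K : ConvexBody (EuclideanSpace ℝ (Fin n)))
    (v : EuclideanSpace ℝ (Fin n)) : ∃ x ∈ K, ⟪x, v⟫ = supportFn K v := by
  obtain ⟨x, hx, h⟩ := K.isCompact.exists_sSup_image_eq K.nonempty
    (f := fun x => ⟪x, v⟫) (by fun_prop)
  exact ⟨x, hx, h.symm⟩

theorem supportFn_le {K : ConvexBody (EuclideanSpace ℝ (Fin n))} {v : EuclideanSpace ℝ (Fin n)}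
    {s : ℝ} (h : ∀ x ∈ K, ⟪x, v⟫ ≤ s) : supportFn K v ≤ s := by
  obtain ⟨x, hx, hxv⟩ := exists_inner_eq_supportFn K v
  exact hxv ▸ h x hx

theorem mem_sum_iff {ι : Type*} [Fintype ι] (L : ι → ConvexBody (EuclideanSpace ℝ (Fin n)))
    (c : ι → ℝ) (x : EuclideanSpace ℝ (Fin n)) :
    x ∈ (∑ i, c i • L i : ConvexBody (EuclideanSpace ℝ (Fin n))) ↔
      ∃ z : ι → EuclideanSpace ℝ (Fin n), (∀ i, z i ∈ L i) ∧ ∑ i, c i • z i = x := by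
  have hcoe : ((∑ i, c i • L i : ConvexBody (EuclideanSpace ℝ (Fin n))) :
      Set (EuclideanSpace ℝ (Fin n))) = ∑ i, c i • (L i : Set (EuclideanSpace ℝ (Fin n))) := by
    let f : ConvexBody (EuclideanSpace ℝ (Fin n)) →+ Set (EuclideanSpace ℝ (Fin n)) :=
      { toFun := fun K => K, map_zero' := ConvexBody.coe_zero, map_add' := ConvexBody.coe_add }
    exact map_sum f (fun i => c i • L i) Finset.univ
  rw [← SetLike.mem_coe, hcoe, Set.mem_finsetSum]
  constructor
  · rintro ⟨g, hg, rfl⟩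
    choose z hz hzg using fun i => Set.mem_smul_set.mp (hg (Finset.mem_univ i))
    exact ⟨z, hz, by simp [hzg]⟩
  · rintro ⟨z, hz, rfl⟩
    exact ⟨fun i => c i • z i, fun {i} _ => Set.smul_mem_smul_set (hz i), rfl⟩

theorem supportFn_sum {ι : Type*} [Fintype ι] (L : ι → ConvexBody (EuclideanSpace ℝ (Fin n)))
    {c : ι → ℝ} (hc : ∀ i, 0 ≤ c i) (v : EuclideanSpace ℝ (Fin n)) :
    supportFn (∑ i, c i • L i) v = ∑ i, c i * supportFn (L i) v := by
  apply le_antisymm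
  · refine supportFn_le fun x hx => ?_
    obtain ⟨z, hz, rfl⟩ := (mem_sum_iff L c x).mp hx
    rw [sum_inner]
    refine Finset.sum_le_sum fun i _ => ?_
    rw [real_inner_smul_left]
    exact mul_le_mul_of_nonneg_left (inner_le_supportFn (hz i) v) (hc i)
  · choose z hz hzv using fun i => exists_inner_eq_supportFn (L i) v
    have h := inner_le_supportFn ((mem_sum_iff L c _).mpr ⟨z, hz, rfl⟩) v
    rw [sum_inner] at h
    simpa only [real_inner_smul_left, hzv] using h

/-! ### The nearest point map -/

theorem exists_nearestPt (K : ConvexBody (EuclideanSpace ℝ (Fin n)))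
    (q : EuclideanSpace ℝ (Fin n)) : ∃ x ∈ K, ∀ y ∈ K, ⟪q - x, y - x⟫ ≤ 0 := by
  obtain ⟨x, hx, h⟩ := exists_norm_eq_iInf_of_complete_convex K.nonempty
    K.isCompact.isComplete K.convex q
  exact ⟨x, hx, (norm_eq_iInf_iff_real_inner_le_zero K.convex hx).mp h⟩

/-- The nearest point of `K` to `q`, characterised by its variational inequality. -/
noncomputable def nearestPt (K : ConvexBody (EuclideanSpace ℝ (Fin n)))
    (q : EuclideanSpace ℝ (Fin n)) : EuclideanSpace ℝ (Fin n) :=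
  (exists_nearestPt K q).choose

section NearestPt

variable (K : ConvexBody (EuclideanSpace ℝ (Fin n)))

theorem nearestPt_mem (q : EuclideanSpace ℝ (Fin n)) : nearestPt K q ∈ K :=
  (exists_nearestPt K q).choose_spec.1

theorem inner_sub_nearestPt_le (q : EuclideanSpace ℝ (Fin n)) {y : EuclideanSpace ℝ (Fin n)}
    (hy : y ∈ K) : ⟪q - nearestPt K q, y - nearestPt K q⟫ ≤ 0 :=
  (exists_nearestPt K q).choose_spec.2 y hy

/-- The nearest point map is firmly nonexpansive. -/
theorem norm_nearestPt_sub_sq_le (p q : EuclideanSpace ℝ (Fin n)) :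
    ‖nearestPt K p - nearestPt K q‖ ^ 2 ≤ ⟪nearestPt K p - nearestPt K q, p - q⟫ := by
  have h1 := inner_sub_nearestPt_le K p (nearestPt_mem K q)
  have h2 := inner_sub_nearestPt_le K q (nearestPt_mem K p)
  rw [← real_inner_self_eq_norm_sq, real_inner_comm (p - q)]
  simp only [inner_sub_left, inner_sub_right] at h1 h2 ⊢
  linarith [real_inner_comm (nearestPt K p) (nearestPt K q)]

theorem eq_nearestPt {q x : EuclideanSpace ℝ (Fin n)} (hx : x ∈ K)
    (h : ∀ y ∈ K, ⟪q - x, y - x⟫ ≤ 0) : nearestPt K q = x := by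
  have h1 := inner_sub_nearestPt_le K q hx
  have h2 := h _ (nearestPt_mem K q)
  rw [← sub_eq_zero, ← norm_eq_zero, ← sq_eq_zero_iff, ← real_inner_self_eq_norm_sq]
  refine le_antisymm ?_ real_inner_self_nonneg
  simp only [inner_sub_left, inner_sub_right] at h1 h2 ⊢
  linarith [real_inner_comm (nearestPt K q) x]

theorem lipschitzWith_nearestPt : LipschitzWith 1 (nearestPt K) := by
  refine LipschitzWith.of_dist_le_mul fun p q => ?_
  have h := norm_nearestPt_sub_sq_le K p q
  have h' := real_inner_le_norm (nearestPt K p - nearestPt K q) (p - q)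
  rw [dist_eq_norm, dist_eq_norm, NNReal.coe_one, one_mul]
  by_contra! hlt
  have := norm_nonneg (p - q)
  nlinarith

/-- Two points with the same nearest point have that nearest point along their whole segment. -/
theorem nearestPt_add_smul {p q : EuclideanSpace ℝ (Fin n)} (h : nearestPt K p = nearestPt K q)
    {s : ℝ} (h0 : 0 ≤ s) (h1 : s ≤ 1) : nearestPt K (p + s • (q - p)) = nearestPt K p := by
  refine eq_nearestPt K (nearestPt_mem K p) fun y hy => ?_
  have e1 := inner_sub_nearestPt_le K p hy
  have e2 := inner_sub_nearestPt_le K q hy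
  rw [← h] at e2
  have : p + s • (q - p) - nearestPt K p =
      (1 - s) • (p - nearestPt K p) + s • (q - nearestPt K p) := by module
  rw [this, inner_add_left, real_inner_smul_left, real_inner_smul_left]
  nlinarith

theorem mem_iff_forall_inner_le {x : EuclideanSpace ℝ (Fin n)} :
    x ∈ K ↔ ∀ v, ⟪x, v⟫ ≤ supportFn K v := by
  refine ⟨fun hx v => inner_le_supportFn hx v, fun h => ?_⟩
  have h1 : supportFn K (x - nearestPt K x) ≤ ⟪nearestPt K x, x - nearestPt K x⟫ :=
    supportFn_le fun y hy => by
      have := inner_sub_nearestPt_le K x hy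
      rw [real_inner_comm, inner_sub_left] at this
      linarith
  have h2 := (h (x - nearestPt K x)).trans h1
  have h3 : x - nearestPt K x = 0 := by
    rw [← norm_eq_zero, ← sq_eq_zero_iff, ← real_inner_self_eq_norm_sq]
    refine le_antisymm ?_ real_inner_self_nonneg
    rw [inner_sub_left]
    linarith
  rw [sub_eq_zero.mp h3]
  exact nearestPt_mem K x

/-- The Moreau envelope `x ↦ max_{z ∈ K} (⟪x, z⟫ - ‖z‖² / 2)`, a convex potential of the nearest
point map, written through the maximiser. -/
noncomputable def nearestPotential (x : EuclideanSpace ℝ (Fin n)) : ℝ :=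
  ⟪x, nearestPt K x⟫ - ‖nearestPt K x‖ ^ 2 / 2

theorem le_nearestPotential (x : EuclideanSpace ℝ (Fin n)) {z : EuclideanSpace ℝ (Fin n)}
    (hz : z ∈ K) : ⟪x, z⟫ - ‖z‖ ^ 2 / 2 ≤ nearestPotential K x := by
  have h1 := inner_sub_nearestPt_le K x hz
  have h2 : (0 : ℝ) ≤ ⟪z - nearestPt K x, z - nearestPt K x⟫ := real_inner_self_nonneg
  unfold nearestPotential
  simp only [← real_inner_self_eq_norm_sq, inner_sub_left, inner_sub_right] at h1 h2 ⊢
  linarith [real_inner_comm (nearestPt K x) z]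

theorem nearestPotential_sub_le (x y : EuclideanSpace ℝ (Fin n)) :
    nearestPotential K y - nearestPotential K x ≤ ⟪y - x, nearestPt K y⟫ := by
  have := le_nearestPotential K x (nearestPt_mem K y)
  have e : nearestPotential K y = ⟪y, nearestPt K y⟫ - ‖nearestPt K y‖ ^ 2 / 2 := rfl
  rw [inner_sub_left, e]
  linarith

theorem continuous_nearestPotential : Continuous (nearestPotential K) := by
  have := (lipschitzWith_nearestPt K).continuous
  unfold nearestPotential
  fun_prop

end NearestPt

/-! ### Weighted sums of nearest point maps -/

section SumNearestPt

variable {ι : Type*} [Fintype ι] (L : ι → ConvexBody (EuclideanSpace ℝ (Fin n))) (c : ι → ℝ)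

/-- The weighted sum `∑ cᵢ P_{Lᵢ}` of the nearest point maps of the bodies `Lᵢ`. -/
noncomputable def sumNearestPt (x : EuclideanSpace ℝ (Fin n)) : EuclideanSpace ℝ (Fin n) :=
  ∑ i, c i • nearestPt (L i) x

theorem sumNearestPt_mem (x : EuclideanSpace ℝ (Fin n)) :
    sumNearestPt L c x ∈ (∑ i, c i • L i : ConvexBody (EuclideanSpace ℝ (Fin n))) :=
  (mem_sum_iff L c _).mpr ⟨_, fun i => nearestPt_mem (L i) x, rfl⟩

theorem exists_lipschitzWith_sumNearestPt : ∃ C, LipschitzWith C (sumNearestPt L c) := by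
  classical
  refine ⟨∑ i, ‖c i‖₊ * 1, LipschitzWith.of_dist_le_mul fun x y => ?_⟩
  rw [dist_eq_norm, sumNearestPt, sumNearestPt, ← Finset.sum_sub_distrib, NNReal.coe_sum,
    Finset.sum_mul]
  refine (norm_sum_le _ _).trans (Finset.sum_le_sum fun i _ => ?_)
  rw [← smul_sub, norm_smul, mul_one, coe_nnnorm]
  gcongr
  simpa [dist_eq_norm] using (lipschitzWith_nearestPt (L i)).dist_le_mul x y

variable {c}

theorem inner_sumNearestPt_sub_nonneg (hc : ∀ i, 0 ≤ c i) (x y : EuclideanSpace ℝ (Fin n)) :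
    0 ≤ ⟪sumNearestPt L c x - sumNearestPt L c y, x - y⟫ := by
  rw [sumNearestPt, sumNearestPt, ← Finset.sum_sub_distrib, sum_inner]
  refine Finset.sum_nonneg fun i _ => ?_
  rw [← smul_sub, real_inner_smul_left]
  exact mul_nonneg (hc i) ((sq_nonneg _).trans (norm_nearestPt_sub_sq_le (L i) x y))

/-- If `∑ cᵢ P_{Lᵢ}` takes the same value at two points, it is constant on their segment. -/
theorem sumNearestPt_add_smul (hc : ∀ i, 0 ≤ c i) {p q : EuclideanSpace ℝ (Fin n)}
    (h : sumNearestPt L c p = sumNearestPt L c q) {s : ℝ} (h0 : 0 ≤ s) (h1 : s ≤ 1) :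
    sumNearestPt L c (p + s • (q - p)) = sumNearestPt L c p := by
  have hsum : ∑ i, c i * ⟪nearestPt (L i) p - nearestPt (L i) q, p - q⟫ = 0 := by
    have : ⟪sumNearestPt L c p - sumNearestPt L c q, p - q⟫ = 0 := by simp [h]
    rw [sumNearestPt, sumNearestPt, ← Finset.sum_sub_distrib, sum_inner] at this
    simpa only [← smul_sub, real_inner_smul_left] using this
  have hnn : ∀ i, 0 ≤ ⟪nearestPt (L i) p - nearestPt (L i) q, p - q⟫ := fun i =>
    (sq_nonneg _).trans (norm_nearestPt_sub_sq_le (L i) p q)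
  have hz := (Finset.sum_eq_zero_iff_of_nonneg fun i _ => mul_nonneg (hc i) (hnn i)).mp hsum
  refine Finset.sum_congr rfl fun i _ => ?_
  rcases mul_eq_zero.mp (hz i (Finset.mem_univ i)) with hi | hi
  · simp [hi]
  · have h2 := norm_nearestPt_sub_sq_le (L i) p q
    rw [hi] at h2
    have h3 : nearestPt (L i) p - nearestPt (L i) q = 0 := by
      rw [← norm_eq_zero, ← sq_eq_zero_iff]
      exact le_antisymm h2 (sq_nonneg _)
    rw [nearestPt_add_smul (L i) (sub_eq_zero.mp h3) h0 h1]

/-- Every interior point `y` of `∑ cᵢ Lᵢ` is a value of `∑ cᵢ P_{Lᵢ}`: it is attained at a minimum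
of the coercive function `∑ cᵢ φᵢ - ⟪·, y⟫`, where `φᵢ` is the potential of `P_{Lᵢ}`. -/
theorem interior_subset_range_sumNearestPt (hc : ∀ i, 0 ≤ c i) :
    interior ((∑ i, c i • L i : ConvexBody (EuclideanSpace ℝ (Fin n))) :
      Set (EuclideanSpace ℝ (Fin n))) ⊆ range (sumNearestPt L c) := by
  intro y hy
  obtain ⟨δ, hδ, hball⟩ := Metric.isOpen_iff.mp isOpen_interior y hy
  have hcT : Continuous (sumNearestPt L c) :=
    (exists_lipschitzWith_sumNearestPt L c).choose_spec.continuous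
  let f : EuclideanSpace ℝ (Fin n) → ℝ := fun x => ∑ i, c i * nearestPotential (L i) x - ⟪x, y⟫
  have hf : Continuous f := by
    have := fun i => continuous_nearestPotential (L i)
    fun_prop
  choose R hR using fun i => (L i).isBounded.exists_norm_le
  have hlow : ∀ x, δ / 2 * ‖x‖ - ∑ i, c i * (R i ^ 2 / 2) ≤ f x := by
    intro x
    have hmem : y + (δ / 2 * ‖x‖⁻¹) • x ∈
        (∑ i, c i • L i : ConvexBody (EuclideanSpace ℝ (Fin n))) := by
      refine interior_subset (hball ?_)
      rw [Metric.mem_ball, dist_eq_norm, add_sub_cancel_left, norm_smul, Real.norm_eq_abs,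
        abs_of_nonneg (by positivity), mul_assoc]
      have : ‖x‖⁻¹ * ‖x‖ ≤ 1 := inv_mul_le_one
      nlinarith
    obtain ⟨z, hz, hzy⟩ := (mem_sum_iff L c _).mp hmem
    have h1 : ∑ i, c i * (⟪x, z i⟫ - R i ^ 2 / 2) ≤ ∑ i, c i * nearestPotential (L i) x := by
      refine Finset.sum_le_sum fun i _ => mul_le_mul_of_nonneg_left ?_ (hc i)
      have := le_nearestPotential (L i) x (hz i)
      have h2 := hR i (z i) (hz i)
      have h3 := norm_nonneg (z i)
      nlinarith
    have h2 : ∑ i, c i * ⟪x, z i⟫ = ⟪x, y⟫ + δ / 2 * ‖x‖ := by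
      have : ∑ i, c i * ⟪x, z i⟫ = ⟪x, ∑ i, c i • z i⟫ := by
        simp only [inner_sum, real_inner_smul_right]
      rw [this, hzy, inner_add_right, real_inner_smul_right, real_inner_self_eq_norm_sq]
      rcases eq_or_ne ‖x‖ 0 with h | h
      · simp [h]
      · field_simp
    simp only [mul_sub, Finset.sum_sub_distrib] at h1
    simp only [f]
    linarith
  have hlim : Tendsto f (cocompact _) atTop := by
    refine tendsto_atTop_mono hlow (tendsto_atTop_add_const_right _ _ ?_)
    exact (tendsto_norm_cocompact_atTop).const_mul_atTop (by positivity)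
  obtain ⟨x, hx⟩ := hf.exists_forall_le hlim
  refine ⟨x, ?_⟩
  have hvar : ∀ x', 0 ≤ ⟪x' - x, sumNearestPt L c x' - y⟫ := by
    intro x'
    have h1 := hx x'
    have h2 : ∑ i, c i * (nearestPotential (L i) x' - nearestPotential (L i) x) ≤
        ∑ i, c i * ⟪x' - x, nearestPt (L i) x'⟫ :=
      Finset.sum_le_sum fun i _ =>
        mul_le_mul_of_nonneg_left (nearestPotential_sub_le (L i) x x') (hc i)
    have h3 : ∑ i, c i * ⟪x' - x, nearestPt (L i) x'⟫ = ⟪x' - x, sumNearestPt L c x'⟫ := by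
      simp only [sumNearestPt, inner_sum, real_inner_smul_right]
    simp only [mul_sub, Finset.sum_sub_distrib] at h2
    rw [inner_sub_right, ← h3]
    have h4 : ⟪x' - x, y⟫ = ⟪x', y⟫ - ⟪x, y⟫ := inner_sub_left _ _ _
    simp only [f] at h1
    linarith
  -- move from `x` in the direction `y - T x` and let the step tend to zero
  set v := y - sumNearestPt L c x with hv
  have hlim2 : Tendsto (fun s : ℝ => ⟪v, sumNearestPt L c (x + s • v) - y⟫) (𝓝[>] 0)
      (𝓝 ⟪v, sumNearestPt L c (x + (0 : ℝ) • v) - y⟫) :=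
    (Continuous.tendsto (by fun_prop) 0).mono_left nhdsWithin_le_nhds
  have hge : 0 ≤ ⟪v, sumNearestPt L c (x + (0 : ℝ) • v) - y⟫ := by
    refine ge_of_tendsto hlim2 (eventually_mem_nhdsWithin.mono fun s hs => ?_)
    have := hvar (x + s • v)
    rw [add_sub_cancel_left, real_inner_smul_left] at this
    exact nonneg_of_mul_nonneg_right this hs
  rw [zero_smul, add_zero, ← neg_sub, ← hv, inner_neg_right, real_inner_self_eq_norm_sq] at hge
  have : v = 0 := by
    rw [← norm_eq_zero, ← sq_eq_zero_iff]
    exact le_antisymm (by linarith) (sq_nonneg _)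
  exact (sub_eq_zero.mp this).symm

/-! ### The volume of a Minkowski sum as an integral of determinants -/

/-- The determinant of a linear map with nonnegative quadratic form is nonnegative: it does not
vanish on the segment from the identity to the map, except possibly at the endpoint. -/
theorem det_nonneg_of_inner_nonneg {E : Type*} [NormedAddCommGroup E] [InnerProductSpace ℝ E]
    [FiniteDimensional ℝ E] (A : E →L[ℝ] E) (hA : ∀ d, 0 ≤ ⟪A d, d⟫) : 0 ≤ A.det := by
  let B : ℝ → E →L[ℝ] E := fun θ => θ • A + (1 - θ) • ContinuousLinearMap.id ℝ E
  have hB : Continuous fun θ => (B θ).det :=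
    ContinuousLinearMap.continuous_det.comp (by fun_prop)
  have h0 : (B 0).det = 1 := by simp [B, ContinuousLinearMap.det]
  have h1 : (B 1).det = A.det := by simp [B]
  have hne : ∀ θ ∈ Ico (0 : ℝ) 1, (B θ).det ≠ 0 := by
    intro θ hθ hdet
    have hker := LinearMap.det_eq_zero_iff_ker_ne_bot.mp hdet
    obtain ⟨d, hd, hd0⟩ := (Submodule.ne_bot_iff _).mp hker
    have h2 : ⟪B θ d, d⟫ = 0 := by
      have : B θ d = 0 := hd
      rw [this, inner_zero_left]
    have h3 : ⟪B θ d, d⟫ = θ * ⟪A d, d⟫ + (1 - θ) * ‖d‖ ^ 2 := by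
      simp [B, inner_add_left, real_inner_smul_left]
    have h4 : 0 < ‖d‖ := norm_pos_iff.mpr hd0
    have h5 := mul_nonneg hθ.1 (hA d)
    have h6 : 0 < (1 - θ) * ‖d‖ ^ 2 := mul_pos (by linarith [hθ.2]) (by positivity)
    linarith
  by_contra! hneg
  rw [← h1] at hneg
  obtain ⟨θ, hθ, hz⟩ := intermediate_value_Icc' (zero_le_one' ℝ) hB.continuousOn
    (show (0 : ℝ) ∈ Icc ((B 1).det) ((B 0).det) from ⟨hneg.le, by rw [h0]; exact zero_le_one⟩)
  rcases hθ.2.lt_or_eq with h | h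
  · exact hne θ ⟨hθ.1, h⟩ hz
  · rw [h] at hz
    exact hneg.ne hz

theorem volume_image_eq_zero_of_lipschitz {C : ℝ≥0}
    {f : EuclideanSpace ℝ (Fin n) → EuclideanSpace ℝ (Fin n)} (hf : LipschitzWith C f)
    {s : Set (EuclideanSpace ℝ (Fin n))} (hs : volume s = 0) : volume (f '' s) = 0 := by
  have hne := Measure.addHaarScalarFactor_volume_hausdorffMeasure_ne_zero n
  rw [← EuclideanSpace.euclideanHausdorffMeasure_eq_volume,
    Measure.euclideanHausdorffMeasure_def] at hs ⊢
  rw [Measure.smul_apply, smul_eq_zero] at hs ⊢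
  refine Or.inr (le_antisymm ((hf.hausdorffMeasure_image_le n.cast_nonneg s).trans ?_) zero_le)
  rw [hs.resolve_left hne, mul_zero]

theorem inner_fderiv_sumNearestPt_nonneg (hc : ∀ i, 0 ≤ c i) {x : EuclideanSpace ℝ (Fin n)}
    (hx : DifferentiableAt ℝ (sumNearestPt L c) x) (d : EuclideanSpace ℝ (Fin n)) :
    0 ≤ ⟪fderiv ℝ (sumNearestPt L c) x d, d⟫ := by
  have hl : HasDerivAt (fun s : ℝ => sumNearestPt L c (x + s • d))
      (fderiv ℝ (sumNearestPt L c) x d) 0 := hx.hasFDerivAt.hasLineDerivAt d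
  have hg : HasDerivAt (fun s : ℝ => ⟪sumNearestPt L c (x + s • d), d⟫)
      ⟪fderiv ℝ (sumNearestPt L c) x d, d⟫ 0 := by
    simpa using hl.inner ℝ (hasDerivAt_const (0 : ℝ) d)
  have hmono : Monotone fun s : ℝ => ⟪sumNearestPt L c (x + s • d), d⟫ := by
    intro s t hst
    have h := inner_sumNearestPt_sub_nonneg L hc (x + t • d) (x + s • d)
    have e : x + t • d - (x + s • d) = (t - s) • d := by module
    rw [e, real_inner_smul_right] at h
    rcases hst.eq_or_lt with rfl | hlt
    · exact le_rfl
    · have := nonneg_of_mul_nonneg_right h (sub_pos.mpr hlt)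
      rw [inner_sub_left] at this
      exact sub_nonneg.mp this
  rw [← hg.deriv]
  exact hmono.deriv_nonneg

theorem injOn_sumNearestPt (hc : ∀ i, 0 ≤ c i) :
    InjOn (sumNearestPt L c) {x | DifferentiableAt ℝ (sumNearestPt L c) x ∧
      (fderiv ℝ (sumNearestPt L c) x).det ≠ 0} := by
  rintro x ⟨hx, hdet⟩ y - hxy
  have hl : HasDerivAt (fun s : ℝ => sumNearestPt L c (x + s • (y - x)))
      (fderiv ℝ (sumNearestPt L c) x (y - x)) 0 := hx.hasFDerivAt.hasLineDerivAt _
  have hconst : HasDerivWithinAt (fun s : ℝ => sumNearestPt L c (x + s • (y - x))) 0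
      (Icc 0 1) 0 := by
    refine (hasDerivWithinAt_const (0 : ℝ) (Icc 0 1) (sumNearestPt L c x)).congr ?_ (by simp)
    exact fun s hs => sumNearestPt_add_smul L hc hxy hs.1 hs.2
  have hu : UniqueDiffWithinAt ℝ (Icc (0 : ℝ) 1) 0 :=
    uniqueDiffOn_Icc zero_lt_one 0 (left_mem_Icc.mpr zero_le_one)
  have hz : fderiv ℝ (sumNearestPt L c) x (y - x) = 0 := hu.eq_deriv _ hl.hasDerivWithinAt hconst
  have hker : (fderiv ℝ (sumNearestPt L c) x).toLinearMap.ker = ⊥ := by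
    by_contra h
    exact hdet (LinearMap.det_eq_zero_iff_ker_ne_bot.mpr h)
  have : y - x ∈ (fderiv ℝ (sumNearestPt L c) x).toLinearMap.ker := hz
  rw [hker, Submodule.mem_bot, sub_eq_zero] at this
  exact this.symm

/-- The volume of `∑ cᵢ Lᵢ` is the volume of the image of `∑ cᵢ P_{Lᵢ}`, which the area formula
turns into an integral: the map is injective where its derivative is invertible, and the remaining
points have an image of measure zero. -/
theorem volume_sum_eq_lintegral_det (hc : ∀ i, 0 ≤ c i) :
    volume ((∑ i, c i • L i : ConvexBody (EuclideanSpace ℝ (Fin n))) :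
      Set (EuclideanSpace ℝ (Fin n))) =
      ∫⁻ x, ENNReal.ofReal ((fderiv ℝ (sumNearestPt L c) x).det) := by
  set T := sumNearestPt L c with hT
  obtain ⟨C, hC⟩ := exists_lipschitzWith_sumNearestPt L c
  let D : Set (EuclideanSpace ℝ (Fin n)) := {x | DifferentiableAt ℝ T x}
  let G : Set (EuclideanSpace ℝ (Fin n)) := {x | DifferentiableAt ℝ T x ∧ (fderiv ℝ T x).det ≠ 0}
  let Z : Set (EuclideanSpace ℝ (Fin n)) := {x | DifferentiableAt ℝ T x ∧ (fderiv ℝ T x).det = 0}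
  have hDm : MeasurableSet D := measurableSet_of_differentiableAt ℝ T
  have hdm : Measurable fun x => (fderiv ℝ T x).det :=
    ContinuousLinearMap.continuous_det.measurable.comp (measurable_fderiv ℝ T)
  have hGm : MeasurableSet G := hDm.inter (hdm (measurableSet_singleton 0).compl)
  have hD0 : volume Dᶜ = 0 := hC.ae_differentiableAt
  have hrange : range T = T '' G ∪ (T '' Z ∪ T '' Dᶜ) := by
    rw [← image_union, ← image_union, ← image_univ]
    congr 1
    ext x
    simp only [G, Z, D, mem_univ, mem_union, mem_ofPred_eq, mem_compl_iff, true_iff]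
    tauto
  have hZ : volume (T '' Z) = 0 :=
    addHaar_image_eq_zero_of_det_fderivWithin_eq_zero volume
      (fun x hx => hx.1.hasFDerivAt.hasFDerivWithinAt) fun x hx => hx.2
  have h1 : volume (range T) = volume (T '' G) := by
    refine le_antisymm ?_ (measure_mono (image_subset_range _ _))
    rw [hrange]
    refine (measure_union_le _ _).trans ?_
    rw [measure_union_null hZ (volume_image_eq_zero_of_lipschitz hC hD0), add_zero]
  have h2 : ∫⁻ x in G, ENNReal.ofReal |(fderiv ℝ T x).det| = volume (T '' G) :=
    lintegral_abs_det_fderiv_eq_addHaar_image volume hGm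
      (fun x hx => hx.1.hasFDerivAt.hasFDerivWithinAt) (injOn_sumNearestPt L hc)
  have h3 : ∫⁻ x in G, ENNReal.ofReal |(fderiv ℝ T x).det| =
      ∫⁻ x, ENNReal.ofReal ((fderiv ℝ T x).det) := by
    rw [← lintegral_indicator hGm]
    refine lintegral_congr_ae ?_
    filter_upwards [hC.ae_differentiableAt (μ := volume)] with x hx
    by_cases hdet : (fderiv ℝ T x).det = 0
    · rw [indicator_of_notMem (fun h => h.2 hdet), hdet, ENNReal.ofReal_zero]
    · rw [indicator_of_mem (show x ∈ G from ⟨hx, hdet⟩), abs_of_nonneg]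
      exact det_nonneg_of_inner_nonneg _ (inner_fderiv_sumNearestPt_nonneg L hc hx)
  rw [← h3, h2, ← h1]
  refine le_antisymm ?_ (measure_mono ?_)
  · rw [measure_congr (interior_ae_eq_of_null_frontier
      ((ConvexBody.convex _).addHaar_frontier volume)).symm]
    exact measure_mono (interior_subset_range_sumNearestPt L hc)
  · rintro _ ⟨x, rfl⟩
    exact sumNearestPt_mem L c x

theorem fderiv_sumNearestPt_ae (c : ι → ℝ) : ∀ᵐ x, fderiv ℝ (sumNearestPt L c) x =
    ∑ i, c i • fderiv ℝ (nearestPt (L i)) x := by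
  filter_upwards [eventually_countable_forall.mpr fun i =>
    (lipschitzWith_nearestPt (L i)).ae_differentiableAt (μ := volume)] with x hx
  have : HasFDerivAt (sumNearestPt L c) (∑ i, c i • fderiv ℝ (nearestPt (L i)) x) x := by
    have := HasFDerivAt.fun_sum (u := Finset.univ) fun i _ => (hx i).hasFDerivAt.const_smul (c i)
    exact this
  exact this.fderiv

/-! ### Existence of the volume polynomial -/

/-- For linear maps `Aᵢ`, the function `c ↦ det (∑ cᵢ Aᵢ)` is a homogeneous polynomial. -/
theorem exists_isHomogeneous_det
    (A : ι → EuclideanSpace ℝ (Fin n) →L[ℝ] EuclideanSpace ℝ (Fin n)) :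
    ∃ p : MvPolynomial ι ℝ, p.IsHomogeneous n ∧
      ∀ c : ι → ℝ, MvPolynomial.eval c p = (∑ i, c i • A i).det := by
  let b := (EuclideanSpace.basisFun (Fin n) ℝ).toBasis
  let a : ι → Matrix (Fin n) (Fin n) ℝ := fun i => LinearMap.toMatrix b b (A i)
  let m : Matrix (Fin n) (Fin n) (MvPolynomial ι ℝ) :=
    fun j k => ∑ i, MvPolynomial.C (a i j k) * MvPolynomial.X i
  refine ⟨m.det, ?_, fun c => ?_⟩
  · rw [Matrix.det_apply]
    refine MvPolynomial.IsHomogeneous.sum _ _ _ fun σ _ => ?_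
    have h : (∏ k, m (σ k) k).IsHomogeneous (∑ _k : Fin n, 1) :=
      MvPolynomial.IsHomogeneous.prod _ _ _ fun k _ =>
        MvPolynomial.IsHomogeneous.sum _ _ _ fun i _ => MvPolynomial.isHomogeneous_C_mul_X _ _
    rw [Finset.sum_const, Finset.card_univ, Fintype.card_fin, smul_eq_mul, mul_one] at h
    rcases Int.units_eq_one_or (Equiv.Perm.sign σ) with hs | hs
    · rw [hs, one_smul]
      exact h
    · rw [hs, Units.neg_smul, one_smul]
      exact h.neg
  · rw [RingHom.map_det, ContinuousLinearMap.det, ← LinearMap.det_toMatrix b]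
    congr 1
    ext j k
    rw [RingHom.mapMatrix_apply, Matrix.map_apply]
    simp [m, a, Matrix.sum_apply, mul_comm]

/-- A homogeneous polynomial of degree `n` is determined, linearly, by its values at the points
with coordinates in `{0, …, n}`. -/
theorem exists_interpolation (ι : Type*) [Fintype ι] (n : ℕ) :
    ∃ ρ : ((ι → Fin (n + 1)) → ℝ) →ₗ[ℝ] MvPolynomial.homogeneousSubmodule ι ℝ n,
      ∀ p (hp : p.IsHomogeneous n),
        ρ (fun k => MvPolynomial.eval (fun i => ((k i : ℕ) : ℝ)) p) = ⟨p, hp⟩ := by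
  classical
  let ev : MvPolynomial.homogeneousSubmodule ι ℝ n →ₗ[ℝ] ((ι → Fin (n + 1)) → ℝ) :=
    { toFun := fun p k => MvPolynomial.eval (fun i => ((k i : ℕ) : ℝ)) (p : MvPolynomial ι ℝ)
      map_add' := fun p q => by ext k; simp
      map_smul' := fun r p => by ext k; simp [MvPolynomial.smul_eval] }
  have hker : LinearMap.ker ev = ⊥ := by
    rw [LinearMap.ker_eq_bot']
    rintro ⟨p, hp⟩ h
    have hp' : p.IsHomogeneous n := hp
    suffices p = 0 from Subtype.ext this
    refine MvPolynomial.eq_zero_of_eval_zero_at_prod_finset p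
      (fun _ => (Finset.range (n + 1)).image fun k : ℕ => (k : ℝ)) (fun i => ?_) fun x hx => ?_
    · rw [Finset.card_image_of_injective _ Nat.cast_injective, Finset.card_range]
      exact Nat.lt_succ_of_le ((MvPolynomial.degreeOf_le_totalDegree p i).trans hp'.totalDegree_le)
    · simp only [Finset.mem_image, Finset.mem_range] at hx
      choose k hk hkx using hx
      have := congrFun h fun i => ⟨k i, hk i⟩
      simpa [ev, hkx] using this
  obtain ⟨ρ, hρ⟩ := LinearMap.exists_leftInverse_of_injective ev hker
  exact ⟨ρ, fun p hp => LinearMap.congr_fun hρ ⟨p, hp⟩⟩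

/-- Minkowski's theorem: the volume of `∑ cᵢ Lᵢ` is a homogeneous polynomial of degree `n` in
`c ≥ 0`. -/
theorem exists_volume_polynomial :
    ∃ p : MvPolynomial ι ℝ, p.IsHomogeneous n ∧ ∀ c : ι → ℝ, (∀ i, 0 ≤ c i) →
      volume.real ((∑ i, c i • L i : ConvexBody (EuclideanSpace ℝ (Fin n))) :
        Set (EuclideanSpace ℝ (Fin n))) = MvPolynomial.eval c p := by
  classical
  let F : (ι → ℝ) → EuclideanSpace ℝ (Fin n) → ℝ := fun c x =>
    (∑ i, c i • fderiv ℝ (nearestPt (L i)) x).det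
  have hFm : ∀ c, Measurable (F c) := fun c =>
    ContinuousLinearMap.continuous_det.measurable.comp
      (Finset.measurable_fun_sum _ fun i _ =>
        (measurable_fderiv ℝ (nearestPt (L i))).const_smul (c i))
  have hFnn : ∀ c : ι → ℝ, (∀ i, 0 ≤ c i) → 0 ≤ᵐ[volume] F c := by
    intro c hc
    filter_upwards [fderiv_sumNearestPt_ae L c,
      (exists_lipschitzWith_sumNearestPt L c).choose_spec.ae_differentiableAt (μ := volume)]
      with x hx hd
    simp only [F, Pi.zero_apply]
    rw [← hx]
    exact det_nonneg_of_inner_nonneg _ (inner_fderiv_sumNearestPt_nonneg L hc hd)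
  have hvol : ∀ c : ι → ℝ, (∀ i, 0 ≤ c i) →
      volume ((∑ i, c i • L i : ConvexBody (EuclideanSpace ℝ (Fin n))) :
        Set (EuclideanSpace ℝ (Fin n))) = ∫⁻ x, ENNReal.ofReal (F c x) := by
    intro c hc
    rw [volume_sum_eq_lintegral_det L hc]
    refine lintegral_congr_ae ?_
    filter_upwards [fderiv_sumNearestPt_ae L c] with x hx
    rw [hx]
  have hint : ∀ c : ι → ℝ, (∀ i, 0 ≤ c i) → Integrable (F c) := by
    intro c hc
    refine ⟨(hFm c).aestronglyMeasurable, ?_⟩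
    rw [hasFiniteIntegral_iff_ofReal (hFnn c hc), ← hvol c hc]
    exact (ConvexBody.isCompact _).measure_lt_top
  have hvol' : ∀ c : ι → ℝ, (∀ i, 0 ≤ c i) →
      volume.real ((∑ i, c i • L i : ConvexBody (EuclideanSpace ℝ (Fin n))) :
        Set (EuclideanSpace ℝ (Fin n))) = ∫ x, F c x := by
    intro c hc
    rw [integral_eq_lintegral_of_nonneg_ae (hFnn c hc) (hFm c).aestronglyMeasurable, ← hvol c hc]
    rfl
  obtain ⟨ρ, hρ⟩ := exists_interpolation ι n
  let node : (ι → Fin (n + 1)) → ι → ℝ := fun k i => ((k i : ℕ) : ℝ)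
  have hnode : ∀ k i, 0 ≤ node k i := fun k i => Nat.cast_nonneg _
  let p := ρ fun k => ∫ x, F (node k) x
  refine ⟨p, p.2, fun c hc => ?_⟩
  -- evaluation at `c` of the interpolating polynomial, as a function of the values at the nodes
  let ℓ : ((ι → Fin (n + 1)) → ℝ) →ₗ[ℝ] ℝ :=
    { toFun := fun w => MvPolynomial.eval c (ρ w : MvPolynomial ι ℝ)
      map_add' := fun v w => by simp
      map_smul' := fun r w => by simp [MvPolynomial.smul_eval] }
  have hℓ : ∀ x, ℓ (fun k => F (node k) x) = F c x := by
    intro x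
    obtain ⟨q, hq, hqe⟩ := exists_isHomogeneous_det fun i => fderiv ℝ (nearestPt (L i)) x
    have h := hρ q hq
    simp only [hqe] at h
    change MvPolynomial.eval c (ρ (fun k => F (node k) x) : MvPolynomial ι ℝ) = F c x
    have e : ρ (fun k => F (node k) x) = ⟨q, hq⟩ := h
    rw [e]
    exact hqe c
  have hsum : ∀ w : (ι → Fin (n + 1)) → ℝ,
      ℓ w = ∑ k, w k * ℓ (fun j => if k = j then 1 else 0) := by
    intro w
    simpa using LinearMap.pi_apply_eq_sum_univ ℓ w
  rw [hvol' c hc]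
  change _ = ℓ fun k => ∫ x, F (node k) x
  rw [hsum]
  simp only [← integral_mul_const]
  rw [← integral_finsetSum _ fun k _ => (hint _ (hnode k)).mul_const _]
  refine integral_congr_ae (Eventually.of_forall fun x => ?_)
  rw [← hℓ x, hsum]

end SumNearestPt

/-! ### Mixed volumes by polarization -/

theorem ext_supportFn {K L : ConvexBody (EuclideanSpace ℝ (Fin n))}
    (h : ∀ v, supportFn K v = supportFn L v) : K = L := by
  refine SetLike.ext fun x => ?_
  rw [mem_iff_forall_inner_le, mem_iff_forall_inner_le]
  simp only [h]

theorem supportFn_smul_add_smul (K L : ConvexBody (EuclideanSpace ℝ (Fin n))) {a b : ℝ}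
    (ha : 0 ≤ a) (hb : 0 ≤ b) (v : EuclideanSpace ℝ (Fin n)) :
    supportFn (a • K + b • L) v = a * supportFn K v + b * supportFn L v := by
  have h := supportFn_sum ![K, L] (c := ![a, b]) (by
    intro i
    fin_cases i
    · exact ha
    · exact hb) v
  simpa [Fin.sum_univ_two] using h

/-- The coefficient of `c₁ ⋯ cₙ` in a homogeneous polynomial of degree `n` is an alternating sum of
its values at the vertices of the unit cube. -/
theorem coeff_one_eq_sum_eval {p : MvPolynomial (Fin n) ℝ} (hp : p.IsHomogeneous n) :
    p.coeff (Finsupp.equivFunOnFinite.symm fun _ => 1) =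
      ∑ T : Finset (Fin n), (-1) ^ T.card *
        MvPolynomial.eval (fun i => if i ∈ T then 0 else 1) p := by
  classical
  set e : Fin n →₀ ℕ := Finsupp.equivFunOnFinite.symm fun _ => 1 with he
  have hmon : ∀ d ∈ p.support, ∑ T : Finset (Fin n), (-1 : ℝ) ^ T.card *
      ∏ i, (if i ∈ T then (0 : ℝ) else 1) ^ d i = if d = e then 1 else 0 := by
    intro d hd
    have h1 : ∀ T : Finset (Fin n), ∏ i, (if i ∈ T then (0 : ℝ) else 1) ^ d i =
        ∏ i ∈ T, (0 : ℝ) ^ d i := by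
      intro T
      rw [← Finset.prod_subset (Finset.subset_univ T) fun i _ hi => by simp [hi]]
      exact Finset.prod_congr rfl fun i hi => by simp [hi]
    simp only [h1]
    have h2 := Finset.prod_one_add (Finset.univ : Finset (Fin n)) (f := fun i => -1 * (0 : ℝ) ^ d i)
    simp only [Finset.powerset_univ, Finset.prod_mul_distrib, Finset.prod_const] at h2
    rw [← h2]
    by_cases hde : d = e
    · rw [if_pos hde]
      exact Finset.prod_eq_one fun i _ => by simp [hde, he]
    · rw [if_neg hde]
      have hdeg : ∑ i, d i = n := by
        have := hp (MvPolynomial.mem_support_iff.mp hd)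
        rw [Finsupp.weight_apply, Finsupp.sum_fintype _ _ (by simp)] at this
        simpa using this
      have hex : ∃ i, d i = 0 := by
        by_contra! hne
        have hle : ∀ i ∈ (Finset.univ : Finset (Fin n)), 1 ≤ d i := fun i _ =>
          Nat.one_le_iff_ne_zero.mpr (hne i)
        have heq := (Finset.sum_eq_sum_iff_of_le hle).mp (by simp [hdeg])
        exact hde (Finsupp.ext fun i => (heq i (Finset.mem_univ i)).symm)
      obtain ⟨i, hi⟩ := hex
      exact Finset.prod_eq_zero (Finset.mem_univ i) (by simp [hi])
  simp only [MvPolynomial.eval_eq', Finset.mul_sum]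
  rw [Finset.sum_comm]
  have h3 : ∀ d ∈ p.support, ∑ T : Finset (Fin n), (-1 : ℝ) ^ T.card *
      (p.coeff d * ∏ i, (if i ∈ T then (0 : ℝ) else 1) ^ d i) =
      p.coeff d * if d = e then 1 else 0 := by
    intro d hd
    rw [← hmon d hd, Finset.mul_sum]
    exact Finset.sum_congr rfl fun T _ => by ring
  rw [Finset.sum_congr rfl h3]
  simp only [mul_ite, mul_one, mul_zero, Finset.sum_ite_eq']
  split_ifs with h
  · rfl
  · exact MvPolynomial.notMem_support_iff.mp h

theorem mixedVolume_eq_sum (L : Fin n → ConvexBody (EuclideanSpace ℝ (Fin n))) :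
    mixedVolume L = (∑ T : Finset (Fin n), (-1) ^ T.card *
      volume.real ((∑ i, (if i ∈ T then (0 : ℝ) else 1) • L i :
        ConvexBody (EuclideanSpace ℝ (Fin n))) : Set (EuclideanSpace ℝ (Fin n)))) /
      (n.factorial : ℝ) := by
  obtain ⟨p, hp, hpv⟩ := exists_volume_polynomial L
  have hex : ∃ p : MvPolynomial (Fin n) ℝ, IsVolumePolynomial L p := ⟨p, hpv⟩
  rw [mixedVolume, dif_pos hex, hex.choose_spec.unique hpv, coeff_one_eq_sum_eval hp]
  congr 1
  refine Finset.sum_congr rfl fun T _ => ?_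
  rw [hpv _ fun i => by split_ifs <;> norm_num]

theorem mixedVolume_comp_equiv (L : Fin n → ConvexBody (EuclideanSpace ℝ (Fin n)))
    (σ : Equiv.Perm (Fin n)) : mixedVolume (L ∘ σ) = mixedVolume L := by
  rw [mixedVolume_eq_sum, mixedVolume_eq_sum]
  congr 1
  refine Fintype.sum_equiv (Equiv.finsetCongr σ) _ _ fun T => ?_
  rw [Equiv.finsetCongr_apply, Finset.card_map]
  congr 3
  rw [← Equiv.sum_comp σ fun i =>
    (if i ∈ T.map (Equiv.toEmbedding σ) then (0 : ℝ) else 1) • L i]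
  refine Finset.sum_congr rfl fun i _ => ?_
  simp

theorem sum_finset_eq_sum_powerset_erase (j : Fin n) (F : Finset (Fin n) → ℝ) :
    ∑ T, F T = ∑ T ∈ (Finset.univ.erase j).powerset, (F T + F (insert j T)) := by
  rw [← Finset.powerset_univ, ← Finset.insert_erase (Finset.mem_univ j),
    Finset.sum_powerset_insert (Finset.notMem_erase j _), ← Finset.sum_add_distrib,
    Finset.insert_erase (Finset.mem_univ j)]

/-- If the difference of the volumes of `∑ cᵢ Lᵢ` and `∑ cᵢ L'ᵢ` does not depend on one of the
coefficients, then `L` and `L'` have the same mixed volume. -/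
theorem mixedVolume_congr_of_sub (L L' : Fin n → ConvexBody (EuclideanSpace ℝ (Fin n)))
    (j : Fin n) (h : ∀ c : Fin n → ℝ, (∀ i, 0 ≤ c i) →
      volume.real ((∑ i, c i • L i : ConvexBody (EuclideanSpace ℝ (Fin n))) :
          Set (EuclideanSpace ℝ (Fin n))) -
        volume.real ((∑ i, c i • L' i : ConvexBody (EuclideanSpace ℝ (Fin n))) :
          Set (EuclideanSpace ℝ (Fin n))) =
      volume.real ((∑ i, Function.update c j 0 i • L i :
          ConvexBody (EuclideanSpace ℝ (Fin n))) : Set (EuclideanSpace ℝ (Fin n))) -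
        volume.real ((∑ i, Function.update c j 0 i • L' i :
          ConvexBody (EuclideanSpace ℝ (Fin n))) : Set (EuclideanSpace ℝ (Fin n)))) :
    mixedVolume L = mixedVolume L' := by
  rw [← sub_eq_zero, mixedVolume_eq_sum, mixedVolume_eq_sum, ← sub_div, ← Finset.sum_sub_distrib]
  refine div_eq_zero_iff.mpr (Or.inl ?_)
  rw [sum_finset_eq_sum_powerset_erase j]
  refine Finset.sum_eq_zero fun T hT => ?_
  have hj : j ∉ T := fun hjT => Finset.notMem_erase j _ (Finset.mem_powerset.mp hT hjT)
  have hT' := h (fun i => if i ∈ T then 0 else 1) fun i => by split_ifs <;> norm_num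
  have hupd : Function.update (fun i => if i ∈ T then (0 : ℝ) else 1) j 0 =
      fun i => if i ∈ insert j T then (0 : ℝ) else 1 := by
    ext i
    by_cases hij : i = j
    · simp [hij]
    · simp [hij]
  rw [hupd] at hT'
  rw [Finset.card_insert_of_notMem hj, pow_succ]
  linear_combination (-1 : ℝ) ^ T.card * hT'

/-- The volume of `a L + b K` as a sum of monomials. -/
theorem exists_volume_smul_add_smul (L K : ConvexBody (EuclideanSpace ℝ (Fin n))) :
    ∃ (s : Finset (Fin 2 →₀ ℕ)) (w : (Fin 2 →₀ ℕ) → ℝ), (∀ d ∈ s, d 0 + d 1 = n) ∧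
      ∀ a b : ℝ, 0 ≤ a → 0 ≤ b →
        volume.real ((a • L + b • K : ConvexBody (EuclideanSpace ℝ (Fin n))) :
          Set (EuclideanSpace ℝ (Fin n))) = ∑ d ∈ s, w d * (a ^ d 0 * b ^ d 1) := by
  obtain ⟨p, hp, hpv⟩ := exists_volume_polynomial ![L, K]
  refine ⟨p.support, fun d => p.coeff d, fun d hd => ?_, fun a b ha hb => ?_⟩
  · have := hp (MvPolynomial.mem_support_iff.mp hd)
    rw [Finsupp.weight_apply, Finsupp.sum_fintype _ _ (by simp), Fin.sum_univ_two] at this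
    simpa using this
  · have h := hpv ![a, b] (by
      intro i
      fin_cases i
      · exact ha
      · exact hb)
    simpa [Fin.sum_univ_two, MvPolynomial.eval_eq'] using h

theorem sum_smul_family₁ {m : ℕ} (L K : ConvexBody (EuclideanSpace ℝ (Fin (m + 1))))
    {c : Fin (m + 1) → ℝ} (hc : ∀ i, 0 ≤ c i) :
    ∑ i, c i • family₁ L K i = c 0 • L + (∑ i ∈ Finset.univ.erase 0, c i) • K := by
  refine ext_supportFn fun v => ?_
  rw [supportFn_sum _ hc, supportFn_smul_add_smul _ _ (hc 0) (Finset.sum_nonneg fun i _ => hc i),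
    ← Finset.add_sum_erase _ _ (Finset.mem_univ (0 : Fin (m + 1))), Finset.sum_mul]
  congr 1
  refine Finset.sum_congr rfl fun i hi => ?_
  have : i.val ≠ 0 := fun h => Finset.ne_of_mem_erase hi (Fin.ext h)
  rw [family₁, if_neg this]

/-- The mixed volume `V(L, K[n-1])` as an `(n-1)`-st finite difference. -/
theorem mixedVolume_family₁_eq_sum_choose {m : ℕ}
    (L K : ConvexBody (EuclideanSpace ℝ (Fin (m + 1)))) (f : ℝ → ℝ → ℝ)
    (hf : ∀ a b : ℝ, 0 ≤ a → 0 ≤ b →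
        volume.real ((a • L + b • K : ConvexBody (EuclideanSpace ℝ (Fin (m + 1)))) :
          Set (EuclideanSpace ℝ (Fin (m + 1)))) = f a b) :
    mixedVolume (family₁ L K) = (∑ k ∈ Finset.range (m + 1),
      (m.choose k : ℝ) * ((-1) ^ (m - k) * (f 1 k - f 0 k))) / ((m + 1).factorial : ℝ) := by
  rw [mixedVolume_eq_sum]
  congr 1
  have hcard : (Finset.univ.erase (0 : Fin (m + 1))).card = m := by simp
  have hterm : ∀ T : Finset (Fin (m + 1)),
      volume.real ((∑ i, (if i ∈ T then (0 : ℝ) else 1) • family₁ L K i :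
        ConvexBody (EuclideanSpace ℝ (Fin (m + 1)))) : Set (EuclideanSpace ℝ (Fin (m + 1)))) =
      f (if 0 ∈ T then 0 else 1) (((Finset.univ.erase 0) \ T).card : ℝ) := by
    intro T
    rw [sum_smul_family₁ L K fun i => by split_ifs <;> norm_num, hf]
    · congr 1
      rw [Finset.card_eq_sum_ones, Nat.cast_sum, Finset.sdiff_eq_filter, Finset.sum_filter]
      exact Finset.sum_congr rfl fun i _ => by split_ifs <;> simp_all
    · split_ifs <;> norm_num
    · exact Finset.sum_nonneg fun i _ => by split_ifs <;> norm_num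
  simp only [hterm]
  rw [sum_finset_eq_sum_powerset_erase 0]
  have hpair : ∀ T ∈ (Finset.univ.erase (0 : Fin (m + 1))).powerset,
      (-1 : ℝ) ^ T.card * f (if 0 ∈ T then 0 else 1)
          (((Finset.univ.erase 0) \ T).card : ℝ) +
        (-1) ^ (insert 0 T).card * f (if 0 ∈ insert 0 T then 0 else 1)
          (((Finset.univ.erase 0) \ insert 0 T).card : ℝ) =
      (fun k : ℕ => (-1 : ℝ) ^ k * (f 1 ((m - k : ℕ) : ℝ) - f 0 ((m - k : ℕ) : ℝ))) T.card := by
    intro T hT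
    have hT' := Finset.mem_powerset.mp hT
    have h0 : (0 : Fin (m + 1)) ∉ T := fun h => Finset.notMem_erase 0 _ (hT' h)
    have hs : Finset.univ.erase 0 \ insert 0 T = Finset.univ.erase (0 : Fin (m + 1)) \ T := by
      ext i
      simp only [Finset.mem_sdiff, Finset.mem_erase, Finset.mem_univ, Finset.mem_insert]
      tauto
    rw [hs, Finset.card_sdiff_of_subset hT', hcard, Finset.card_insert_of_notMem h0, if_neg h0,
      if_pos (Finset.mem_insert_self 0 T)]
    ring
  rw [Finset.sum_congr rfl hpair, Finset.sum_powerset_apply_card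
    (fun k : ℕ => (-1 : ℝ) ^ k * (f 1 ((m - k : ℕ) : ℝ) - f 0 ((m - k : ℕ) : ℝ))), hcard,
    ← Finset.sum_range_reflect]
  refine Finset.sum_congr rfl fun k hk => ?_
  have hk' : k ≤ m := Nat.lt_succ_iff.mp (Finset.mem_range.mp hk)
  have e1 : m + 1 - 1 - k = m - k := by omega
  have e2 : m - (m - k) = k := by omega
  rw [e1, e2, Nat.choose_symm hk', nsmul_eq_mul]

theorem sum_choose_neg_one_pow_mul_pow {m j : ℕ} (hj : j ≤ m) :
    ∑ k ∈ Finset.range (m + 1), (m.choose k : ℝ) * ((-1) ^ (m - k) * (k : ℝ) ^ j) =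
      if j = m then (m.factorial : ℝ) else 0 := by
  have h := fwdDiff_iter_eq_sum_shift (1 : ℝ) (fun r : ℝ => r ^ j) m 0
  have e : ∑ k ∈ Finset.range (m + 1), (m.choose k : ℝ) * ((-1) ^ (m - k) * (k : ℝ) ^ j) =
      ∑ k ∈ Finset.range (m + 1), ((-1 : ℤ) ^ (m - k) * m.choose k) •
        (fun r : ℝ => r ^ j) (0 + k • (1 : ℝ)) := by
    refine Finset.sum_congr rfl fun k _ => ?_
    simp only [zsmul_eq_mul, nsmul_eq_mul, mul_one, zero_add]
    push_cast
    ring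
  rw [e, ← h]
  split_ifs with hjm
  · subst hjm
    rw [fwdDiff_iter_eq_factorial]
    rfl
  · rw [fwdDiff_iter_pow_eq_zero_of_lt (lt_of_le_of_ne hj hjm)]
    rfl

/-- `V(L, K[n-1])` is `1 / n` times the right derivative of `a ↦ Vₙ(a L + K)` at `0`, with a
quadratic error term. -/
theorem exists_abs_volume_sub_le {m : ℕ} (L K : ConvexBody (EuclideanSpace ℝ (Fin (m + 1)))) :
    ∃ C : ℝ, 0 ≤ C ∧ ∀ a ∈ Icc (0 : ℝ) 1,
      |volume.real ((a • L + K : ConvexBody (EuclideanSpace ℝ (Fin (m + 1)))) :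
          Set (EuclideanSpace ℝ (Fin (m + 1)))) -
        volume.real (K : Set (EuclideanSpace ℝ (Fin (m + 1)))) -
        (m + 1) * mixedVolume (family₁ L K) * a| ≤ C * a ^ 2 := by
  obtain ⟨s, w, hs, hw⟩ := exists_volume_smul_add_smul L K
  have hmv : (m + 1) * mixedVolume (family₁ L K) = ∑ d ∈ s, w d * if d 0 = 1 then 1 else 0 := by
    rw [mixedVolume_family₁_eq_sum_choose L K _ hw]
    have h1 : ∀ k : ℕ, (m.choose k : ℝ) * ((-1) ^ (m - k) *
        (∑ d ∈ s, w d * (1 ^ d 0 * (k : ℝ) ^ d 1) - ∑ d ∈ s, w d * (0 ^ d 0 * (k : ℝ) ^ d 1))) =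
        ∑ d ∈ s, (w d * (1 - 0 ^ d 0)) *
          ((m.choose k : ℝ) * ((-1) ^ (m - k) * (k : ℝ) ^ d 1)) := by
      intro k
      rw [← Finset.sum_sub_distrib, Finset.mul_sum, Finset.mul_sum]
      exact Finset.sum_congr rfl fun d _ => by ring
    simp only [h1]
    rw [Finset.sum_comm, Nat.factorial_succ, Nat.cast_mul, mul_div_assoc', div_eq_iff
      (by positivity), Finset.mul_sum, Finset.sum_mul]
    refine Finset.sum_congr rfl fun d hd => ?_
    have hd' := hs d hd
    rw [← Finset.mul_sum]
    rcases Nat.eq_zero_or_pos (d 0) with h0 | h0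
    · simp [h0]
    · rw [sum_choose_neg_one_pow_mul_pow (by omega : d 1 ≤ m), zero_pow h0.ne']
      have : d 1 = m ↔ d 0 = 1 := by omega
      simp only [this]
      split_ifs
      · push_cast
        ring
      · ring
  have hK : volume.real (K : Set (EuclideanSpace ℝ (Fin (m + 1)))) =
      ∑ d ∈ s, w d * 0 ^ d 0 := by
    have h := hw 0 1 le_rfl zero_le_one
    have e : (0 : ℝ) • L + (1 : ℝ) • K = K := by
      refine ext_supportFn fun v => ?_
      rw [supportFn_smul_add_smul _ _ le_rfl zero_le_one]
      ring
    rw [e] at h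
    simpa using h
  refine ⟨∑ d ∈ s, |w d|, Finset.sum_nonneg fun d _ => abs_nonneg _, fun a ha => ?_⟩
  have h := hw a 1 ha.1 zero_le_one
  rw [one_smul] at h
  rw [h, hK, hmv, Finset.sum_mul, ← Finset.sum_sub_distrib, ← Finset.sum_sub_distrib,
    Finset.sum_mul]
  refine (Finset.abs_sum_le_sum_abs _ _).trans (Finset.sum_le_sum fun d _ => ?_)
  have e : w d * (a ^ d 0 * 1 ^ d 1) - w d * 0 ^ d 0 - (w d * if d 0 = 1 then 1 else 0) * a =
      w d * (a ^ d 0 - 0 ^ d 0 - (if d 0 = 1 then 1 else 0) * a) := by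
    rw [one_pow]
    ring
  rw [e, abs_mul]
  refine mul_le_mul_of_nonneg_left ?_ (abs_nonneg _)
  rcases Nat.lt_or_ge (d 0) 2 with h2 | h2
  · interval_cases d 0 <;> simp [sq_nonneg]
  · rw [zero_pow (by omega), if_neg (by omega), sub_zero, zero_mul, sub_zero,
      abs_of_nonneg (pow_nonneg ha.1 _)]
    exact pow_le_pow_of_le_one ha.1 ha.2 h2

/-! ### Adding a body which is locally a point -/

theorem supportFn_smul (K : ConvexBody (EuclideanSpace ℝ (Fin n))) {a : ℝ} (ha : 0 ≤ a)
    (v : EuclideanSpace ℝ (Fin n)) : supportFn (a • K) v = a * supportFn K v := by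
  simpa using supportFn_sum (fun _ : Unit => K) (c := fun _ => a) (fun _ => ha) v

theorem supportFn_add_smul_sub_le (K : ConvexBody (EuclideanSpace ℝ (Fin n)))
    (v w : EuclideanSpace ℝ (Fin n)) {s : ℝ} (h0 : 0 ≤ s) (h1 : s ≤ 1) :
    supportFn K (v + s • (w - v)) ≤ (1 - s) * supportFn K v + s * supportFn K w := by
  refine supportFn_le fun x hx => ?_
  have e : v + s • (w - v) = (1 - s) • v + s • w := by module
  rw [e, inner_add_right, real_inner_smul_right, real_inner_smul_right]
  have h2 := mul_le_mul_of_nonneg_left (inner_le_supportFn hx v) (sub_nonneg.mpr h1)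
  have h3 := mul_le_mul_of_nonneg_left (inner_le_supportFn hx w) h0
  exact add_le_add h2 h3

theorem subset_iff_supportFn_le {K L : ConvexBody (EuclideanSpace ℝ (Fin n))} :
    (K : Set (EuclideanSpace ℝ (Fin n))) ⊆ L ↔ ∀ v, supportFn K v ≤ supportFn L v := by
  refine ⟨fun h v => supportFn_le fun x hx => inner_le_supportFn (h hx) v, fun h x hx => ?_⟩
  exact (mem_iff_forall_inner_le L).mpr fun v => (inner_le_supportFn hx v).trans (h v)

/-- Let `Q ⊆ P`, and let `N` look like the point `w` in all directions in which `Q` and `P` differ.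
Then passing from `P` and `Q` to `P + N` and `Q + N` does not change the difference of the volumes,
because `P + N = (P + w) ∪ (Q + N)` and `(P + w) ∩ (Q + N) = Q + w`. The sums `P' = P + N` and
`Q' = Q + N` are given through their support functions. -/
theorem volume_sub_volume_eq_of_supportFn
    {P Q N P' Q' : ConvexBody (EuclideanSpace ℝ (Fin n))} {w : EuclideanSpace ℝ (Fin n)}
    (hP' : ∀ v, supportFn P' v = supportFn P v + supportFn N v)
    (hQ' : ∀ v, supportFn Q' v = supportFn Q v + supportFn N v)
    (hQP : ∀ v, supportFn Q v ≤ supportFn P v) (hw : w ∈ N)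
    (hN : ∀ v, supportFn Q v < supportFn P v → supportFn N v = ⟪w, v⟫) :
    volume.real (P' : Set (EuclideanSpace ℝ (Fin n))) -
        volume.real (Q' : Set (EuclideanSpace ℝ (Fin n))) =
      volume.real (P : Set (EuclideanSpace ℝ (Fin n))) -
        volume.real (Q : Set (EuclideanSpace ℝ (Fin n))) := by
  let τ : EuclideanSpace ℝ (Fin n) → EuclideanSpace ℝ (Fin n) := fun z => z + -w
  have hmem : ∀ (B : ConvexBody (EuclideanSpace ℝ (Fin n))) z,
      z ∈ τ ⁻¹' (B : Set (EuclideanSpace ℝ (Fin n))) ↔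
        ∀ v, ⟪z, v⟫ ≤ supportFn B v + ⟪w, v⟫ := by
    intro B z
    rw [mem_preimage, SetLike.mem_coe, mem_iff_forall_inner_le]
    refine forall_congr' fun v => ?_
    rw [inner_add_left, inner_neg_left]
    constructor <;> intro h <;> linarith
  have hwN := fun v => inner_le_supportFn hw v
  have hunion : (P' : Set (EuclideanSpace ℝ (Fin n))) = τ ⁻¹' P ∪ Q' := by
    apply Subset.antisymm
    · intro z hz
      by_contra hcon
      rw [mem_union, not_or, hmem, SetLike.mem_coe, mem_iff_forall_inner_le] at hcon
      push Not at hcon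
      obtain ⟨⟨b, hb⟩, v, hv⟩ := hcon
      have hz' := (mem_iff_forall_inner_le P').mp hz
      simp only [hP'] at hz'
      rw [hQ'] at hv
      have hvU : supportFn Q v < supportFn P v := by linarith [hz' v]
      have hbU : ¬ supportFn Q b < supportFn P b := fun h => by
        linarith [hz' b, hN b h]
      -- the first point of the segment from `v` to `b` at which `P` and `Q` agree
      let ψ : ℝ → EuclideanSpace ℝ (Fin n) := fun s => v + s • (b - v)
      have hψ : Continuous ψ := by fun_prop
      have hcont : ∀ B : ConvexBody (EuclideanSpace ℝ (Fin n)),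
          Continuous fun s => supportFn B (ψ s) := fun B => continuous_supportFn.comp hψ
      have hclosed : IsClosed {s | supportFn P (ψ s) ≤ supportFn Q (ψ s)} :=
        isClosed_le (hcont P) (hcont Q)
      obtain ⟨s₀, ⟨hs₀, hs₀U⟩, hleast⟩ := (isCompact_Icc.inter_right hclosed).exists_isLeast
        (s := Icc (0 : ℝ) 1 ∩ {s | supportFn P (ψ s) ≤ supportFn Q (ψ s)})
        ⟨1, ⟨zero_le_one, le_rfl⟩, by simpa [ψ] using hbU⟩
      have hpos : 0 < s₀ := by
        rcases hs₀.1.eq_or_lt with h | h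
        · rw [← h] at hs₀U
          simp only [ψ, zero_smul, add_zero, mem_ofPred_eq] at hs₀U
          exact absurd hvU hs₀U.not_gt
        · exact h
      have heqN : supportFn N (ψ s₀) = ⟪w, ψ s₀⟫ := by
        have hcl : IsClosed {s | supportFn N (ψ s) = ⟪w, ψ s⟫} :=
          isClosed_eq (hcont N) (by fun_prop)
        have hsub : Ico 0 s₀ ⊆ {s | supportFn N (ψ s) = ⟪w, ψ s⟫} := by
          intro s hs
          refine hN _ (lt_of_not_ge fun h => ?_)
          exact (hleast ⟨⟨hs.1, hs.2.le.trans hs₀.2⟩, h⟩).not_gt hs.2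
        have := closure_minimal hsub hcl
        rw [closure_Ico hpos.ne] at this
        exact this ⟨hpos.le, le_rfl⟩
      have h1 := supportFn_add_smul_sub_le Q v b hs₀.1 hs₀.2
      have h2 := hz' (ψ s₀)
      have h3 : ∀ x : EuclideanSpace ℝ (Fin n), ⟪x, ψ s₀⟫ = (1 - s₀) * ⟪x, v⟫ + s₀ * ⟪x, b⟫ := by
        intro x
        have e : ψ s₀ = (1 - s₀) • v + s₀ • b := by simp only [ψ]; module
        rw [e, inner_add_right, real_inner_smul_right, real_inner_smul_right]
      have h4 : (1 - s₀) * supportFn Q v ≤ (1 - s₀) * (⟪z, v⟫ - ⟪w, v⟫) :=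
        mul_le_mul_of_nonneg_left (by linarith [hwN v]) (sub_nonneg.mpr hs₀.2)
      have h5 : s₀ * supportFn Q b < s₀ * (⟪z, b⟫ - ⟪w, b⟫) :=
        mul_lt_mul_of_pos_left (by linarith [hQP b]) hpos
      have h6 : supportFn P (ψ s₀) ≤ supportFn Q (ψ s₀) := hs₀U
      rw [heqN, h3, h3] at h2
      change supportFn Q (ψ s₀) ≤ _ at h1
      linarith
    · rintro z (hz | hz)
      · refine (mem_iff_forall_inner_le P').mpr fun v => ?_
        rw [hP']
        linarith [(hmem P z).mp hz v, hwN v]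
      · refine (mem_iff_forall_inner_le P').mpr fun v => ?_
        rw [hP']
        have := inner_le_supportFn (K := Q') hz v
        rw [hQ'] at this
        linarith [hQP v]
  have hinter : (τ ⁻¹' P ∩ Q' : Set (EuclideanSpace ℝ (Fin n))) = τ ⁻¹' Q := by
    apply Subset.antisymm
    · rintro z ⟨hzP, hzQ⟩
      rw [hmem] at hzP ⊢
      intro v
      by_cases hv : supportFn Q v < supportFn P v
      · have := inner_le_supportFn (K := Q') hzQ v
        rwa [hQ', hN v hv] at this
      · linarith [hzP v, le_antisymm (hQP v) (not_lt.mp hv)]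
    · intro z hz
      rw [hmem] at hz
      refine ⟨(hmem P z).mpr fun v => (hz v).trans (by linarith [hQP v]), ?_⟩
      refine (mem_iff_forall_inner_le Q').mpr fun v => ?_
      rw [hQ']
      linarith [hz v, hwN v]
  have htrans : ∀ B : ConvexBody (EuclideanSpace ℝ (Fin n)),
      volume.real (τ ⁻¹' (B : Set (EuclideanSpace ℝ (Fin n)))) =
        volume.real (B : Set (EuclideanSpace ℝ (Fin n))) := by
    intro B
    simp only [Measure.real, τ, measure_preimage_add_right]
  have hfin : volume (τ ⁻¹' (P : Set (EuclideanSpace ℝ (Fin n)))) ≠ ∞ := by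
    simp only [τ, measure_preimage_add_right]
    exact P.isCompact.measure_lt_top.ne
  have h := measureReal_union_add_inter (μ := volume) (s := τ ⁻¹' (P : Set _))
    Q'.isClosed.measurableSet hfin Q'.isCompact.measure_lt_top.ne
  rw [← hunion, hinter, htrans, htrans] at h
  linarith

/-! ### Truncations at an exposed point -/

/-- The intersection of a convex body with a closed convex set meeting it. -/
def interBody (K : ConvexBody (EuclideanSpace ℝ (Fin n))) {S : Set (EuclideanSpace ℝ (Fin n))}
    (hS : Convex ℝ S) (hcl : IsClosed S)
    (hne : ((K : Set (EuclideanSpace ℝ (Fin n))) ∩ S).Nonempty) :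
    ConvexBody (EuclideanSpace ℝ (Fin n)) :=
  ⟨K ∩ S, K.convex.inter hS, K.isCompact.inter_right hcl, hne⟩

/-- If the face of `K` with normal `u` is a single point `x₀`, then small caps of `K` in direction
`u` are close to `x₀`. -/
theorem exists_cap_subset_ball {K : ConvexBody (EuclideanSpace ℝ (Fin n))}
    {u x₀ : EuclideanSpace ℝ (Fin n)} (hx₀ : ∀ x ∈ face K u, x = x₀) {r : ℝ} (hr : 0 < r) :
    ∃ t > 0, ∀ z ∈ K, supportFn K u - t < ⟪z, u⟫ → ‖z - x₀‖ < r := by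
  rcases ((K : Set (EuclideanSpace ℝ (Fin n))) \ Metric.ball x₀ r).eq_empty_or_nonempty with h | h
  · refine ⟨1, one_pos, fun z hz _ => ?_⟩
    rw [← dist_eq_norm]
    exact sdiff_eq_empty.mp h hz
  · obtain ⟨z₁, ⟨hz₁, hz₁r⟩, hmax⟩ := (K.isCompact.diff Metric.isOpen_ball).exists_isMaxOn h
      (f := fun z => ⟪z, u⟫) (by fun_prop)
    have hlt : ⟪z₁, u⟫ < supportFn K u := by
      refine lt_of_le_of_ne (inner_le_supportFn hz₁ u) fun heq => hz₁r ?_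
      rw [hx₀ z₁ ⟨hz₁, heq⟩]
      exact Metric.mem_ball_self hr
    refine ⟨supportFn K u - ⟪z₁, u⟫, sub_pos.mpr hlt, fun z hz hzt => ?_⟩
    by_contra hzr
    have : ⟪z, u⟫ ≤ ⟪z₁, u⟫ := hmax ⟨hz, by rwa [Metric.mem_ball, dist_eq_norm]⟩
    linarith

/-- If the face of `K` with normal `u` is a single point `x₀`, there are a truncation `T` of `K`
near `x₀` and a body `M` which has `x₀` as a vertex and looks like the point `x₀` in all directions
in which the truncation changes the support function. -/
theorem exists_truncation_vertex {K : ConvexBody (EuclideanSpace ℝ (Fin n))}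
    {y : EuclideanSpace ℝ (Fin n)} {r : ℝ} (hr : 0 < r)
    (hy : ∀ w : EuclideanSpace ℝ (Fin n), ‖w‖ ≤ 2 * r → y + w ∈ K)
    {u x₀ : EuclideanSpace ℝ (Fin n)} (hu : ‖u‖ = 1) (hx₀K : x₀ ∈ K)
    (hx₀ : ∀ x ∈ face K u, x = x₀) :
    ∃ T M : ConvexBody (EuclideanSpace ℝ (Fin n)),
      (∀ v, supportFn T v ≤ supportFn K v) ∧ supportFn T u < supportFn K u ∧
      Metric.closedBall y r ⊆ (T : Set (EuclideanSpace ℝ (Fin n))) ∧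
      Metric.closedBall y r ⊆ (M : Set (EuclideanSpace ℝ (Fin n))) ∧
      x₀ ∈ M ∧ ∀ v, supportFn T v < supportFn K v → supportFn M v = ⟪x₀, v⟫ := by
  obtain ⟨t₀, ht₀, hcap₀⟩ := exists_cap_subset_ball hx₀ hr
  set t := min t₀ r with ht
  have htpos : 0 < t := lt_min ht₀ hr
  have hcap : ∀ z ∈ K, supportFn K u - t < ⟪z, u⟫ → ‖z - x₀‖ < r := fun z hz h =>
    hcap₀ z hz (by linarith [min_le_left t₀ r])
  -- a ball of radius `r` around `y` stays away from every supporting hyperplane by `r`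
  have hball : ∀ y' ∈ Metric.closedBall y r, ∀ v : EuclideanSpace ℝ (Fin n),
      ⟪y', v⟫ + r * ‖v‖ ≤ supportFn K v := by
    intro y' hy' v
    have hmem : y' + (r * ‖v‖⁻¹) • v ∈ K := by
      have e : y' + (r * ‖v‖⁻¹) • v = y + ((y' - y) + (r * ‖v‖⁻¹) • v) := by abel
      rw [e]
      refine hy _ ((norm_add_le _ _).trans ?_)
      rw [Metric.mem_closedBall, dist_eq_norm] at hy'
      have h1 : ‖(r * ‖v‖⁻¹) • v‖ ≤ r := by
        rw [norm_smul, Real.norm_eq_abs, abs_of_nonneg (by positivity), mul_assoc]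
        have : ‖v‖⁻¹ * ‖v‖ ≤ 1 := inv_mul_le_one
        nlinarith
      linarith
    have := inner_le_supportFn hmem v
    rw [inner_add_left, real_inner_smul_left, real_inner_self_eq_norm_sq] at this
    rcases eq_or_ne ‖v‖ 0 with h | h
    · rw [h] at this ⊢
      simpa using this
    · have e : r * ‖v‖⁻¹ * ‖v‖ ^ 2 = r * ‖v‖ := by field_simp
      rwa [e] at this
  have hsubK : ∀ y' ∈ Metric.closedBall y r, y' ∈ K := fun y' hy' =>
    (mem_iff_forall_inner_le K).mpr fun v => by
      have := mul_nonneg hr.le (norm_nonneg v)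
      linarith [hball y' hy' v]
  have hH : Metric.closedBall y r ⊆ {z | ⟪z, u⟫ ≤ supportFn K u - t} := by
    intro y' hy'
    have := hball y' hy' u
    rw [hu, mul_one] at this
    rw [mem_ofPred_eq]
    linarith [min_le_right t₀ r]
  have hyB : y ∈ Metric.closedBall y r := Metric.mem_closedBall_self hr.le
  let T := interBody K (S := {z | ⟪z, u⟫ ≤ supportFn K u - t})
    (convex_halfSpace_le (IsLinearMap.mk (fun a b => inner_add_left a b _)
      fun c a => real_inner_smul_left a _ c) _)
    (isClosed_le (by fun_prop) (by fun_prop)) ⟨y, hsubK y hyB, hH hyB⟩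
  have hTK : ∀ v, supportFn T v ≤ supportFn K v := subset_iff_supportFn_le.mp inter_subset_left
  let M := interBody K (S := ⋂ v ∈ {v | supportFn T v < supportFn K v}, {z | ⟪z, v⟫ ≤ ⟪x₀, v⟫})
    (convex_iInter fun v => convex_iInter fun _ =>
      convex_halfSpace_le (IsLinearMap.mk (fun a b => inner_add_left a b _)
        fun c a => real_inner_smul_left a _ c) _)
    (isClosed_iInter fun v => isClosed_iInter fun _ =>
      isClosed_le (by fun_prop) (by fun_prop)) ⟨x₀, hx₀K, by simp⟩
  have hx₀M : x₀ ∈ M := ⟨hx₀K, by simp⟩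
  refine ⟨T, M, hTK, ?_, fun y' hy' => ⟨hsubK y' hy', hH hy'⟩,
    fun y' hy' => ⟨hsubK y' hy', ?_⟩, hx₀M, fun v hv => ?_⟩
  · have : supportFn T u ≤ supportFn K u - t := supportFn_le fun x hx => hx.2
    linarith
  · simp only [mem_iInter, mem_ofPred_eq]
    intro v hv
    obtain ⟨z, hz, hzv⟩ := exists_inner_eq_supportFn K v
    have hzT : supportFn K u - t < ⟪z, u⟫ := by
      by_contra! hle
      have : z ∈ T := ⟨hz, hle⟩
      linarith [inner_le_supportFn this v]
    have h1 := hcap z hz hzT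
    have h2 := real_inner_le_norm (z - x₀) v
    rw [inner_sub_left, hzv] at h2
    have h3 := hball y' hy' v
    nlinarith [norm_nonneg v]
  · refine le_antisymm (supportFn_le fun x hx => ?_) (inner_le_supportFn hx₀M v)
    have := hx.2
    simp only [mem_iInter, mem_ofPred_eq] at this
    exact this v hv

/-! ### Consequences of the Bezout inequality -/

theorem mixedVolume_family₂_eq_family₁ {m : ℕ}
    {K T M : ConvexBody (EuclideanSpace ℝ (Fin (m + 2)))} {x₀ : EuclideanSpace ℝ (Fin (m + 2))}
    (hTK : ∀ v, supportFn T v ≤ supportFn K v) (hx₀ : x₀ ∈ M)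
    (hM : ∀ v, supportFn T v < supportFn K v → supportFn M v = ⟪x₀, v⟫) :
    mixedVolume (family₂ T M K) = mixedVolume (family₁ M K) := by
  have hswap : family₁ M K = family₂ K M K ∘ Equiv.swap (0 : Fin (m + 2)) 1 := by
    funext i
    rcases eq_or_ne i 0 with rfl | h0
    · simp [family₁, family₂]
    · rcases eq_or_ne i 1 with rfl | h1
      · simp [family₁, family₂]
      · have h0' : i.val ≠ 0 := fun h => h0 (Fin.ext h)
        have h1' : i.val ≠ 1 := fun h => h1 (Fin.ext h)
        simp [family₁, family₂, Equiv.swap_apply_of_ne_of_ne h0 h1, h0', h1']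
  rw [hswap, mixedVolume_comp_equiv]
  symm
  refine mixedVolume_congr_of_sub _ _ 1 fun c hc => ?_
  have hupd : ∀ i, 0 ≤ Function.update c 1 0 i := by
    intro i
    rcases eq_or_ne i 1 with rfl | h
    · simp
    · simpa [h] using hc i
  have hsplit : ∀ A v, supportFn (∑ i, c i • family₂ A M K i) v =
      supportFn (∑ i, Function.update c 1 0 i • family₂ A M K i) v +
        supportFn (c 1 • M) v := by
    intro A v
    rw [supportFn_sum _ hc, supportFn_sum _ hupd, supportFn_smul _ (hc 1),
      ← Finset.add_sum_erase _ _ (Finset.mem_univ (1 : Fin (m + 2))),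
      ← Finset.add_sum_erase _ _ (Finset.mem_univ (1 : Fin (m + 2)))]
    have e : family₂ A M K 1 = M := by simp [family₂]
    rw [e, Function.update_self, zero_mul, zero_add, add_comm]
    congr 1
    exact Finset.sum_congr rfl fun i hi => by
      rw [Function.update_of_ne (Finset.ne_of_mem_erase hi)]
  have hfam : ∀ i v, supportFn (family₂ T M K i) v ≤ supportFn (family₂ K M K i) v := by
    intro i v
    unfold family₂
    split_ifs
    · exact hTK v
    · exact le_rfl
    · exact le_rfl
  refine volume_sub_volume_eq_of_supportFn (w := c 1 • x₀) (hsplit K) (hsplit T) (fun v => ?_)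
    ?_ fun v hv => ?_
  · rw [supportFn_sum _ hupd, supportFn_sum _ hupd]
    exact Finset.sum_le_sum fun i _ => mul_le_mul_of_nonneg_left (hfam i v) (hupd i)
  · exact Set.smul_mem_smul_set hx₀
  · rw [supportFn_smul _ (hc 1), real_inner_smul_left, hM v]
    by_contra hcon
    have heq : supportFn T v = supportFn K v := le_antisymm (hTK v) (not_lt.mp hcon)
    refine hv.ne ?_
    rw [supportFn_sum _ hupd, supportFn_sum _ hupd]
    refine Finset.sum_congr rfl fun i _ => ?_
    unfold family₂
    split_ifs
    · rw [heq]
    · rfl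
    · rfl

theorem volume_real_smul (K : ConvexBody (EuclideanSpace ℝ (Fin n))) {a : ℝ} (ha : 0 ≤ a) :
    volume.real ((a • K : ConvexBody (EuclideanSpace ℝ (Fin n))) :
      Set (EuclideanSpace ℝ (Fin n))) =
      a ^ n * volume.real (K : Set (EuclideanSpace ℝ (Fin n))) := by
  rw [ConvexBody.coe_smul, Measure.real, Measure.addHaar_smul, finrank_euclideanSpace_fin,
    abs_of_nonneg (pow_nonneg ha n), ENNReal.toReal_mul, ENNReal.toReal_ofReal (pow_nonneg ha n)]
  rfl

/-- `V(M, K[n-1])` is positive for bodies with interior points: `M` contains a translate of a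
positive multiple `l K` of `K`, so that `Vₙ(a M + K) ≥ (1 + l a)ⁿ Vₙ(K)`. -/
theorem mixedVolume_family₁_pos {m : ℕ} {K M : ConvexBody (EuclideanSpace ℝ (Fin (m + 1)))}
    (hK : 0 < volume.real (K : Set (EuclideanSpace ℝ (Fin (m + 1)))))
    {y : EuclideanSpace ℝ (Fin (m + 1))} {r : ℝ} (hr : 0 < r)
    (hy : Metric.closedBall y r ⊆ (M : Set (EuclideanSpace ℝ (Fin (m + 1))))) :
    0 < mixedVolume (family₁ M K) := by
  obtain ⟨R, hRpos, hR⟩ := K.isBounded.exists_pos_norm_le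
  set l := r / R with hl
  have hlpos : 0 < l := div_pos hr hRpos
  have hsub : ∀ z ∈ K, y + l • z ∈ M := by
    intro z hz
    refine hy ?_
    rw [Metric.mem_closedBall, dist_eq_norm, add_sub_cancel_left, norm_smul, Real.norm_eq_abs,
      abs_of_pos hlpos]
    calc l * ‖z‖ ≤ l * R := mul_le_mul_of_nonneg_left (hR z hz) hlpos.le
      _ = r := by rw [hl]; field_simp
  have hlow : ∀ a : ℝ, 0 ≤ a →
      (1 + l * a) * volume.real (K : Set (EuclideanSpace ℝ (Fin (m + 1)))) ≤
      volume.real ((a • M + K : ConvexBody (EuclideanSpace ℝ (Fin (m + 1)))) :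
        Set (EuclideanSpace ℝ (Fin (m + 1)))) := by
    intro a ha
    have hla : 0 ≤ l * a := mul_nonneg hlpos.le ha
    have h1 : (1 + l * a) * volume.real (K : Set (EuclideanSpace ℝ (Fin (m + 1)))) ≤
        volume.real (((1 + l * a) • K : ConvexBody (EuclideanSpace ℝ (Fin (m + 1)))) :
          Set (EuclideanSpace ℝ (Fin (m + 1)))) := by
      rw [volume_real_smul _ (by linarith)]
      refine mul_le_mul_of_nonneg_right ?_ hK.le
      exact le_self_pow₀ (by linarith) (Nat.succ_ne_zero m)
    refine h1.trans ?_
    have h2 : volume.real ((fun z => z + -(a • y)) ⁻¹'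
        (((1 + l * a) • K : ConvexBody (EuclideanSpace ℝ (Fin (m + 1)))) :
          Set (EuclideanSpace ℝ (Fin (m + 1))))) =
        volume.real (((1 + l * a) • K : ConvexBody (EuclideanSpace ℝ (Fin (m + 1)))) :
          Set (EuclideanSpace ℝ (Fin (m + 1)))) := by
      simp only [Measure.real, measure_preimage_add_right]
    rw [← h2]
    refine measureReal_mono (fun z hz => ?_) (ConvexBody.isCompact _).measure_lt_top.ne
    obtain ⟨k, hk, hkz⟩ := Set.mem_smul_set.mp hz
    have e : z = a • (y + l • k) + k := by
      have : z = (1 + l * a) • k + a • y := by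
        rw [hkz]
        exact (neg_add_cancel_right z (a • y)).symm
      rw [this]
      module
    rw [e]
    exact Set.add_mem_add (Set.smul_mem_smul_set (hsub k hk)) hk
  obtain ⟨C, hC, hexp⟩ := exists_abs_volume_sub_le M K
  by_contra! hneg
  set q := l * volume.real (K : Set (EuclideanSpace ℝ (Fin (m + 1)))) with hq
  have hqpos : 0 < q := mul_pos hlpos hK
  -- with `a = q / (C + q)` the linear gain `q a` exceeds the error `C a²`
  have ha : q / (C + q) ∈ Icc (0 : ℝ) 1 :=
    ⟨by positivity, (div_le_one (by positivity)).mpr (by linarith)⟩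
  have hapos : 0 < q / (C + q) := by positivity
  have h1 := (abs_le.mp (hexp _ ha)).2
  have h2 := hlow _ ha.1
  have h3 : C * (q / (C + q)) < q := by
    rw [mul_div_assoc', div_lt_iff₀ (by positivity)]
    nlinarith
  have h4 : ((m : ℝ) + 1) * mixedVolume (family₁ M K) * (q / (C + q)) ≤ 0 :=
    mul_nonpos_of_nonpos_of_nonneg (mul_nonpos_of_nonneg_of_nonpos (by positivity) hneg) hapos.le
  nlinarith

/-- For a truncation `T` of `K` and a body `M` with vertex `x₀` as in `exists_truncation_vertex`, the
Bezout inequality reduces to `Vₙ(K) ≤ V(T, K[n-1])`. -/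
theorem volume_le_mixedVolume_of_satisfiesBezout {m : ℕ}
    {K T M : ConvexBody (EuclideanSpace ℝ (Fin (m + 2)))} (hB : SatisfiesBezout K)
    (hK : 0 < volume.real (K : Set (EuclideanSpace ℝ (Fin (m + 2)))))
    {x₀ y : EuclideanSpace ℝ (Fin (m + 2))} {r : ℝ} (hr : 0 < r)
    (hTK : ∀ v, supportFn T v ≤ supportFn K v)
    (hyT : Metric.closedBall y r ⊆ (T : Set (EuclideanSpace ℝ (Fin (m + 2)))))
    (hyM : Metric.closedBall y r ⊆ (M : Set (EuclideanSpace ℝ (Fin (m + 2)))))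
    (hx₀ : x₀ ∈ M) (hM : ∀ v, supportFn T v < supportFn K v → supportFn M v = ⟪x₀, v⟫) :
    volume.real (K : Set (EuclideanSpace ℝ (Fin (m + 2)))) ≤ mixedVolume (family₁ T K) := by
  have hint : ∀ B : ConvexBody (EuclideanSpace ℝ (Fin (m + 2))),
      Metric.closedBall y r ⊆ (B : Set (EuclideanSpace ℝ (Fin (m + 2)))) →
      (interior (B : Set (EuclideanSpace ℝ (Fin (m + 2))))).Nonempty := fun B hyB =>
    ⟨y, interior_mono hyB (mem_interior_iff_mem_nhds.mpr (Metric.closedBall_mem_nhds y hr))⟩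
  have h := hB T M (hint T hyT) (hint M hyM)
  rw [mixedVolume_family₂_eq_family₁ hTK hx₀ hM, mul_comm] at h
  exact le_of_mul_le_mul_right h (mixedVolume_family₁_pos hK hr hyM)

/-! ### A packing bound for the surface measure -/

/-- If the separated finite subsets of `A` have bounded cardinality, a maximal one is a net. -/
theorem exists_separated_net {X : Type*} [PseudoMetricSpace X] (A : Set X) {s : ℝ} (hs : 0 ≤ s)
    (B : ℕ) (hB : ∀ F : Finset X, (F : Set X) ⊆ A →
      (F : Set X).Pairwise (fun x y => s < dist x y) → F.card ≤ B) :
    ∃ F : Finset X, (F : Set X) ⊆ A ∧ (F : Set X).Pairwise (fun x y => s < dist x y) ∧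
      A ⊆ ⋃ x : F, Metric.closedBall (x : X) s := by
  classical
  by_contra! hcon
  have hall : ∀ k : ℕ, ∃ F : Finset X, (F : Set X) ⊆ A ∧
      (F : Set X).Pairwise (fun x y => s < dist x y) ∧ F.card = k := by
    intro k
    induction k with
    | zero => exact ⟨∅, by simp, by simp, rfl⟩
    | succ k ih =>
      obtain ⟨F, hFA, hFs, hFk⟩ := ih
      obtain ⟨x, hxA, hx⟩ := not_subset.mp (hcon F hFA hFs)
      simp only [mem_iUnion, Metric.mem_closedBall, not_exists, not_le] at hx
      have hxF : x ∉ F := fun hxF => by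
        have := hx ⟨x, hxF⟩
        rw [dist_self] at this
        exact hs.not_gt this
      refine ⟨insert x F, ?_, ?_, by rw [Finset.card_insert_of_notMem hxF, hFk]⟩
      · rw [Finset.coe_insert]
        exact insert_subset hxA hFA
      · rw [Finset.coe_insert]
        refine hFs.insert fun b hb _ => ⟨hx ⟨b, hb⟩, ?_⟩
        rw [dist_comm]
        exact hx ⟨b, hb⟩
  obtain ⟨F, hFA, hFs, hFk⟩ := hall (B + 1)
  have := hB F hFA hFs
  omega

/-- A set whose `δ a`-separated finite subsets have at most `C a¹⁻ᵐ` elements, for all small `a`,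
has `m`-dimensional Hausdorff measure zero. -/
theorem hausdorffMeasure_eq_zero_of_card_le {X : Type*} [MetricSpace X] [MeasurableSpace X]
    [BorelSpace X] (A : Set X) (m : ℕ) {δ C : ℝ} (hδ : 0 < δ)
    (h : ∀ a : ℝ, 0 < a → a ≤ 1 → ∀ F : Finset X, (F : Set X) ⊆ A →
      (F : Set X).Pairwise (fun x y => δ * a < dist x y) → F.card * a ^ m ≤ C * a) :
    Measure.hausdorffMeasure (m : ℝ) A = 0 := by
  let a : ℕ → ℝ := fun k => 1 / ((k : ℝ) + 1)
  have ha : ∀ k, 0 < a k := fun k => Nat.one_div_pos_of_nat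
  have ha1 : ∀ k, a k ≤ 1 := fun k => by
    simp only [a]
    rw [div_le_one (by positivity)]
    linarith [(Nat.cast_nonneg k : (0 : ℝ) ≤ k)]
  have halim : Tendsto a atTop (𝓝 0) := tendsto_one_div_add_atTop_nhds_zero_nat
  have hnet : ∀ k, ∃ F : Finset X, (F : Set X) ⊆ A ∧
      (F : Set X).Pairwise (fun x y => δ * a k < dist x y) ∧
      A ⊆ ⋃ x : F, Metric.closedBall (x : X) (δ * a k) := by
    intro k
    refine exists_separated_net A (mul_pos hδ (ha k)).le ⌊C * a k / a k ^ m⌋₊ fun F hFA hFs => ?_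
    refine Nat.le_floor ?_
    rw [le_div_iff₀ (pow_pos (ha k) m)]
    exact h (a k) (ha k) (ha1 k) F hFA hFs
  choose F hFA hFs hcov using hnet
  have hdiam : ∀ k (x : F k), Metric.ediam (Metric.closedBall (x : X) (δ * a k)) ≤
      ENNReal.ofReal (2 * (δ * a k)) := by
    intro k x
    rw [ENNReal.ofReal_mul zero_le_two, ENNReal.ofReal_ofNat, ← Metric.closedEBall_ofReal
      (mul_pos hδ (ha k)).le]
    exact Metric.ediam_closedEBall_le
  have hsum : ∀ k, ∑ x : F k, Metric.ediam (Metric.closedBall (x : X) (δ * a k)) ^ (m : ℝ) ≤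
      ENNReal.ofReal ((2 * δ) ^ m * C * a k) := by
    intro k
    calc ∑ x : F k, Metric.ediam (Metric.closedBall (x : X) (δ * a k)) ^ (m : ℝ)
        ≤ ∑ _x : F k, ENNReal.ofReal ((2 * (δ * a k)) ^ m) := by
          refine Finset.sum_le_sum fun x _ => ?_
          rw [ENNReal.rpow_natCast, ENNReal.ofReal_pow (by have := ha k; positivity)]
          gcongr
          exact hdiam k x
      _ = ENNReal.ofReal ((F k).card * (2 * (δ * a k)) ^ m) := by
          rw [Finset.sum_const, Finset.card_univ, Fintype.card_coe, nsmul_eq_mul,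
            ENNReal.ofReal_mul (Nat.cast_nonneg _), ENNReal.ofReal_natCast]
      _ ≤ _ := by
          refine ENNReal.ofReal_le_ofReal ?_
          have h1 := h (a k) (ha k) (ha1 k) (F k) (hFA k) (hFs k)
          calc ((F k).card : ℝ) * (2 * (δ * a k)) ^ m
              = (2 * δ) ^ m * ((F k).card * a k ^ m) := by rw [← mul_assoc 2 δ, mul_pow]; ring
            _ ≤ (2 * δ) ^ m * (C * a k) := mul_le_mul_of_nonneg_left h1 (by positivity)
            _ = _ := by ring
  have hzero : ∀ c : ℝ, Tendsto (fun k => ENNReal.ofReal (c * a k)) atTop (𝓝 0) := by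
    intro c
    have := ENNReal.tendsto_ofReal (halim.const_mul c)
    rwa [mul_zero, ENNReal.ofReal_zero] at this
  have hr : Tendsto (fun k => ENNReal.ofReal (2 * (δ * a k))) atTop (𝓝 0) := by
    simpa only [mul_assoc] using hzero (2 * δ)
  have hle := Measure.hausdorffMeasure_le_liminf_sum (m : ℝ) A (l := atTop)
    (fun k => ENNReal.ofReal (2 * (δ * a k))) hr
    (fun k (x : F k) => Metric.closedBall (x : X) (δ * a k))
    (Eventually.of_forall fun k x => hdiam k x) (Eventually.of_forall hcov)
  refine le_antisymm (hle.trans ?_) zero_le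
  rw [← (hzero ((2 * δ) ^ m * C)).liminf_eq]
  exact liminf_le_liminf (Eventually.of_forall hsum)

/-- Let `T ⊆ K`, and let `A` be a set of points of `K` having an outer unit normal at which the
support functions of `T` and `K` differ by at least `δ`. Then `A` is null for the Hausdorff measure
of dimension `n - 1` if `Vₙ((1 + a) K) - Vₙ(a T + K)` is quadratically small in `a`.

Near each point of `A` the difference of `(1 + a) K` and `a T + K` contains a ball with radius
proportional to `a`, and the balls of `δ a`-separated points are disjoint. -/
theorem hausdorffMeasure_eq_zero_of_volume_sub_le {m : ℕ}
    {K T : ConvexBody (EuclideanSpace ℝ (Fin (m + 1)))}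
    (hTK : ∀ v, supportFn T v ≤ supportFn K v)
    {y : EuclideanSpace ℝ (Fin (m + 1))} {r : ℝ} (hr : 0 < r)
    (hy : ∀ w : EuclideanSpace ℝ (Fin (m + 1)), ‖w‖ ≤ r → y + w ∈ K)
    {C : ℝ} (hC : ∀ a ∈ Icc (0 : ℝ) 1,
      volume.real (((1 + a) • K : ConvexBody (EuclideanSpace ℝ (Fin (m + 1)))) :
          Set (EuclideanSpace ℝ (Fin (m + 1)))) -
        volume.real ((a • T + K : ConvexBody (EuclideanSpace ℝ (Fin (m + 1)))) :
          Set (EuclideanSpace ℝ (Fin (m + 1)))) ≤ C * a ^ 2)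
    {δ : ℝ} (hδ : 0 < δ) {A : Set (EuclideanSpace ℝ (Fin (m + 1)))}
    (hA : ∀ x ∈ A, x ∈ K ∧ ∃ v : EuclideanSpace ℝ (Fin (m + 1)), ‖v‖ = 1 ∧
      ⟪x, v⟫ = supportFn K v ∧ δ ≤ supportFn K v - supportFn T v) :
    Measure.hausdorffMeasure (m : ℝ) A = 0 := by
  obtain ⟨R, hR⟩ := K.isBounded.exists_norm_le
  set D := |R| + ‖y‖ with hD
  have hD0 : 0 ≤ D := by positivity
  have hDx : ∀ x ∈ K, ‖x - y‖ ≤ D := fun x hx =>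
    (norm_sub_le x y).trans (add_le_add_left ((hR x hx).trans (le_abs_self R)) _)
  -- the balls have radius `σ r a`; the choice of `σ` keeps them within `δ a / 2` of `(1 + a) x`
  set σ := δ / (4 * (D + r) + δ) with hσ
  have hσ0 : 0 < σ := by positivity
  have hσ1 : σ ≤ 1 := (div_le_one (by positivity)).mpr (by linarith)
  have hσD : 2 * σ * (D + r) < δ / 2 := by
    rw [hσ, mul_div_assoc', div_mul_eq_mul_div, div_lt_iff₀ (by positivity)]
    nlinarith
  set ω := volume.real (Metric.closedBall (0 : EuclideanSpace ℝ (Fin (m + 1))) 1) with hω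
  have hω0 : 0 < ω := ENNReal.toReal_pos (Metric.measure_closedBall_pos volume _ one_pos).ne'
    measure_closedBall_lt_top.ne
  refine hausdorffMeasure_eq_zero_of_card_le A m (C := C / ((σ * r) ^ (m + 1) * ω)) hδ ?_
  intro a ha0 ha1 F hFA hFs
  set ε := σ * a with hε
  have hε0 : 0 < ε := mul_pos hσ0 ha0
  have hε1 : ε ≤ 1 := mul_le_one₀ hσ1 ha0.le ha1
  let B : EuclideanSpace ℝ (Fin (m + 1)) → Set (EuclideanSpace ℝ (Fin (m + 1))) := fun x =>
    Metric.closedBall ((1 + a) • ((1 - ε) • x + ε • y)) (ε * r)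
  have hnear : ∀ x ∈ K, ∀ z ∈ B x, ‖z - (1 + a) • x‖ < δ * a / 2 := by
    intro x hx z hz
    rw [Metric.mem_closedBall, dist_eq_norm] at hz
    have e : z - (1 + a) • x = (z - (1 + a) • ((1 - ε) • x + ε • y)) -
        ((1 + a) * ε) • (x - y) := by module
    have h1 : ‖((1 + a) * ε) • (x - y)‖ ≤ 2 * ε * D := by
      rw [norm_smul, Real.norm_eq_abs, abs_of_nonneg (by positivity)]
      exact mul_le_mul (mul_le_mul_of_nonneg_right (by linarith) hε0.le) (hDx x hx)
        (norm_nonneg _) (by positivity)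
    have h2 : 2 * ε * D + ε * r ≤ a * (2 * σ * (D + r)) := by
      rw [hε]
      have : 0 ≤ σ * a * r := by positivity
      linarith
    have h3 : a * (2 * σ * (D + r)) < a * (δ / 2) := mul_lt_mul_of_pos_left hσD ha0
    rw [e]
    refine (norm_sub_le _ _).trans_lt ?_
    linarith
  have hsubK : ∀ x ∈ K, B x ⊆ ((1 + a) • K : ConvexBody (EuclideanSpace ℝ (Fin (m + 1)))) := by
    intro x hx z hz
    rw [Metric.mem_closedBall, dist_eq_norm] at hz
    set w := (ε * (1 + a))⁻¹ • (z - (1 + a) • ((1 - ε) • x + ε • y)) with hw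
    have hwr : ‖w‖ ≤ r := by
      rw [hw, norm_smul, Real.norm_eq_abs, abs_of_nonneg (by positivity),
        inv_mul_le_iff₀ (by positivity)]
      refine hz.trans ?_
      have : 0 ≤ ε * r * a := by positivity
      linarith
    have e : z = (1 + a) • ((1 - ε) • x + ε • (y + w)) := by
      have : (ε * (1 + a)) • w = z - (1 + a) • ((1 - ε) • x + ε • y) :=
        smul_inv_smul₀ (by positivity) _
      have e2 : (1 + a) • ((1 - ε) • x + ε • (y + w)) =
          (1 + a) • ((1 - ε) • x + ε • y) + (ε * (1 + a)) • w := by module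
      rw [e2, this]
      abel
    rw [e]
    exact Set.smul_mem_smul_set (K.convex hx (hy w hwr) (by linarith) hε0.le (by ring))
  have hTsum : ∀ v, supportFn (a • T + K) v = a * supportFn T v + supportFn K v := fun v => by
    simpa using supportFn_smul_add_smul T K ha0.le zero_le_one v
  have hout : ∀ x ∈ A, Disjoint (B x)
      ((a • T + K : ConvexBody (EuclideanSpace ℝ (Fin (m + 1)))) :
        Set (EuclideanSpace ℝ (Fin (m + 1)))) := by
    intro x hx
    obtain ⟨hxK, v, hv1, hxv, hδv⟩ := hA x hx
    rw [Set.disjoint_left]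
    intro z hz hzT
    have h1 := inner_le_supportFn (K := a • T + K) hzT v
    rw [hTsum] at h1
    have h2 := (abs_le.mp (abs_real_inner_le_norm (z - (1 + a) • x) v)).1
    rw [hv1, mul_one, inner_sub_left, real_inner_smul_left, hxv] at h2
    have h3 := hnear x hxK z hz
    have h4 := mul_le_mul_of_nonneg_left hδv ha0.le
    nlinarith
  have hdisj : (F : Set (EuclideanSpace ℝ (Fin (m + 1)))).PairwiseDisjoint B := by
    intro x hx x' hx' hne
    rw [Function.onFun, Set.disjoint_left]
    intro z hz hz'
    have h1 := hnear x (hA x (hFA hx)).1 z hz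
    have h2 := hnear x' (hA x' (hFA hx')).1 z hz'
    have h3 := hFs hx hx' hne
    change δ * a < dist x x' at h3
    rw [dist_eq_norm] at h3
    have e : (1 + a) • (x - x') = (z - (1 + a) • x') - (z - (1 + a) • x) := by module
    have h4 : (1 + a) * ‖x - x'‖ ≤ ‖z - (1 + a) • x'‖ + ‖z - (1 + a) • x‖ := by
      have h5 : ‖(1 + a) • (x - x')‖ = (1 + a) * ‖x - x'‖ := by
        rw [norm_smul, Real.norm_eq_abs, abs_of_nonneg (by linarith)]
      rw [← h5, e]
      exact norm_sub_le _ _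
    nlinarith [norm_nonneg (x - x')]
  have hvolB : ∀ x, volume.real (B x) = (ε * r) ^ (m + 1) * ω := by
    intro x
    rw [hω, Measure.real, Measure.addHaar_closedBall' _ _ (by positivity), ENNReal.toReal_mul,
      ENNReal.toReal_ofReal (by positivity), finrank_euclideanSpace_fin]
    rfl
  have hTsub : ((a • T + K : ConvexBody (EuclideanSpace ℝ (Fin (m + 1)))) :
      Set (EuclideanSpace ℝ (Fin (m + 1)))) ⊆
        ((1 + a) • K : ConvexBody (EuclideanSpace ℝ (Fin (m + 1)))) := by
    refine subset_iff_supportFn_le.mpr fun v => ?_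
    rw [hTsum, supportFn_smul _ (by linarith)]
    have := mul_le_mul_of_nonneg_left (hTK v) ha0.le
    linarith
  have hcount : F.card * ((ε * r) ^ (m + 1) * ω) ≤ C * a ^ 2 := by
    refine le_trans ?_ (hC a ⟨ha0.le, ha1⟩)
    rw [← measureReal_sdiff hTsub (ConvexBody.isClosed _).measurableSet
      (ConvexBody.isCompact _).measure_lt_top.ne]
    calc (F.card : ℝ) * ((ε * r) ^ (m + 1) * ω) = ∑ x ∈ F, volume.real (B x) := by
          simp only [hvolB, Finset.sum_const, nsmul_eq_mul]
      _ = volume.real (⋃ x ∈ F, B x) :=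
          (measureReal_biUnion_finset hdisj (fun x _ => Metric.isClosed_closedBall.measurableSet)
            fun x _ => measure_closedBall_lt_top.ne).symm
      _ ≤ _ := by
          refine measureReal_mono (iUnion₂_subset fun x hx => ?_)
            (measure_ne_top_of_subset sdiff_subset (ConvexBody.isCompact _).measure_lt_top.ne)
          exact subset_sdiff.mpr ⟨hsubK x (hA x (hFA hx)).1, hout x (hFA hx)⟩
  rw [div_mul_eq_mul_div, le_div_iff₀ (by positivity)]
  have e : (F.card : ℝ) * ((ε * r) ^ (m + 1) * ω) =
      a * (F.card * a ^ m * ((σ * r) ^ (m + 1) * ω)) := by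
    rw [hε]
    ring
  rw [e] at hcount
  refine le_of_mul_le_mul_left ?_ ha0
  linarith

/-! ### Faces with normals in the support of the surface area measure -/

theorem one_add_pow_le (n : ℕ) {a : ℝ} (h0 : 0 ≤ a) (h1 : a ≤ 1) :
    (1 + a) ^ n ≤ 1 + n * a + 4 ^ n * a ^ 2 := by
  induction n with
  | zero => simp [sq_nonneg]
  | succ k ih =>
    have h4 : (k : ℝ) ≤ 4 ^ k := by exact_mod_cast (Nat.lt_pow_self (by norm_num : 1 < 4)).le
    have ha2 : 0 ≤ a ^ 2 := sq_nonneg a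
    have h5 : a ^ 2 * a ≤ a ^ 2 := mul_le_of_le_one_right ha2 h1
    have h6 : (0 : ℝ) < 4 ^ k := by positivity
    have h7 := mul_le_mul_of_nonneg_right ih (by linarith : 0 ≤ 1 + a)
    rw [pow_succ, pow_succ]
    push_cast
    nlinarith

theorem face_nonempty (K : ConvexBody (EuclideanSpace ℝ (Fin n)))
    (u : EuclideanSpace ℝ (Fin n)) : (face K u).Nonempty :=
  let ⟨x, hx, h⟩ := exists_inner_eq_supportFn K u
  ⟨x, hx, h⟩

theorem eq_of_affineDim_eq_zero {A : Set (EuclideanSpace ℝ (Fin n))} (hA : affineDim A = 0)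
    {x y : EuclideanSpace ℝ (Fin n)} (hx : x ∈ A) (hy : y ∈ A) : x = y := by
  have h := Submodule.finrank_eq_zero.mp hA
  rw [direction_affineSpan] at h
  have := vsub_mem_vectorSpan ℝ hx hy
  rwa [h, Submodule.mem_bot, vsub_eq_zero_iff_eq] at this

end ConvexMixed

/-- If a convex body `K` in `ℝⁿ`, `n ≥ 2`, satisfies
`V(L₁, L₂, K[n-2]) Vₙ(K) ≤ V(L₁, K[n-1]) V(L₂, K[n-1])` for all convex bodies `L₁, L₂`, then
`dim K^u > 0` for every `u` in the support of the surface area measure of `K`. -/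
theorem proposition4p3 {n : ℕ} (hn : 2 ≤ n)
    (K : ConvexBody (EuclideanSpace ℝ (Fin n)))
    (hK : (interior (K : Set (EuclideanSpace ℝ (Fin n)))).Nonempty)
    (hBezout : ConvexMixed.SatisfiesBezout K) :
    ∀ u ∈ (ConvexMixed.surfaceAreaMeasure K hK).support,
      0 < ConvexMixed.affineDim (ConvexMixed.face K (u : EuclideanSpace ℝ (Fin n))) := by
  obtain ⟨m, rfl⟩ : ∃ m, n = m + 2 := ⟨n - 2, by omega⟩
  intro u hu
  refine Nat.pos_of_ne_zero fun hdim => ?_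
  obtain ⟨x₀, hx₀⟩ := ConvexMixed.face_nonempty K u
  obtain ⟨y, hyK⟩ := id hK
  obtain ⟨ρ, hρ, hball⟩ := Metric.isOpen_iff.mp isOpen_interior y hyK
  have hr : 0 < ρ / 4 := by positivity
  have hy : ∀ w : EuclideanSpace ℝ (Fin (m + 2)), ‖w‖ ≤ 2 * (ρ / 4) → y + w ∈ K := by
    intro w hw
    refine interior_subset (hball ?_)
    rw [Metric.mem_ball, dist_eq_norm, add_sub_cancel_left]
    linarith
  have hvol : 0 < volume.real (K : Set (EuclideanSpace ℝ (Fin (m + 2)))) :=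
    ENNReal.toReal_pos (Measure.measure_pos_of_nonempty_interior volume ⟨y, hyK⟩).ne'
      K.isCompact.measure_lt_top.ne
  obtain ⟨T, M, hTK, hTu, hyT, hyM, hx₀M, hM⟩ := ConvexMixed.exists_truncation_vertex hr hy
    (norm_eq_of_mem_sphere u) hx₀.1 fun x hx => ConvexMixed.eq_of_affineDim_eq_zero hdim hx hx₀
  have hV := ConvexMixed.volume_le_mixedVolume_of_satisfiesBezout hBezout hvol hr hTK hyT hyM
    hx₀M hM
  obtain ⟨C, -, hexp⟩ := ConvexMixed.exists_abs_volume_sub_le T K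
  have hC : ∀ a ∈ Set.Icc (0 : ℝ) 1,
      volume.real (((1 + a) • K : ConvexBody (EuclideanSpace ℝ (Fin (m + 2)))) :
          Set (EuclideanSpace ℝ (Fin (m + 2)))) -
        volume.real ((a • T + K : ConvexBody (EuclideanSpace ℝ (Fin (m + 2)))) :
          Set (EuclideanSpace ℝ (Fin (m + 2)))) ≤
      (4 ^ (m + 2) * volume.real (K : Set (EuclideanSpace ℝ (Fin (m + 2)))) + C) * a ^ 2 := by
    intro a ha
    rw [ConvexMixed.volume_real_smul _ (by linarith [ha.1])]
    have h1 := mul_le_mul_of_nonneg_right (ConvexMixed.one_add_pow_le (m + 2) ha.1 ha.2) hvol.le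
    have h2 := (abs_le.mp (hexp a ha)).1
    have h3 : ((m : ℝ) + 2) * a * volume.real (K : Set (EuclideanSpace ℝ (Fin (m + 2)))) ≤
        ((m : ℝ) + 2) * a * ConvexMixed.mixedVolume (ConvexMixed.family₁ T K) :=
      mul_le_mul_of_nonneg_left hV (mul_nonneg (by positivity) ha.1)
    rw [show ((m + 1 : ℕ) : ℝ) + 1 = (m : ℝ) + 2 by push_cast; ring] at h2
    push_cast at h1
    linarith
  -- the directions near `u` in which the truncation changes the support function substantially
  set δ := (ConvexMixed.supportFn K u - ConvexMixed.supportFn T u) / 2 with hδ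
  have hδ0 : 0 < δ := by linarith
  let Ω : Set (Metric.sphere (0 : EuclideanSpace ℝ (Fin (m + 2))) 1) :=
    {v | δ < ConvexMixed.supportFn K v - ConvexMixed.supportFn T v}
  have hΩ : IsOpen Ω := by
    have h1 := (ConvexMixed.continuous_supportFn (K := K)).comp
      (continuous_subtype_val (p := (· ∈ Metric.sphere (0 : EuclideanSpace ℝ (Fin (m + 2))) 1)))
    have h2 := (ConvexMixed.continuous_supportFn (K := T)).comp
      (continuous_subtype_val (p := (· ∈ Metric.sphere (0 : EuclideanSpace ℝ (Fin (m + 2))) 1)))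
    exact isOpen_lt continuous_const (h1.sub h2)
  have huΩ : u ∈ Ω := by
    change δ < _
    linarith
  have hpos := (Measure.mem_support_iff_forall u).mp hu Ω (hΩ.mem_nhds huΩ)
  rw [ConvexMixed.surfaceAreaMeasure_apply hK hΩ.measurableSet,
    Measure.euclideanHausdorffMeasure_def, Measure.smul_apply] at hpos
  have hnull : Measure.hausdorffMeasure ((m + 1 : ℕ) : ℝ)
      (ConvexMixed.invSphericalImage K Ω) = 0 := by
    refine ConvexMixed.hausdorffMeasure_eq_zero_of_volume_sub_le hTK hr
      (fun w hw => hy w (by linarith)) hC hδ0 ?_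
    rintro x ⟨hx, v, hv, hxv⟩
    exact ⟨K.isClosed.frontier_subset hx, v, norm_eq_of_mem_sphere v, hxv, le_of_lt hv⟩
  have e : m + 2 - 1 = m + 1 := rfl
  rw [e, hnull, smul_zero] at hpos
  exact lt_irrefl _ hpos
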